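/- Let $k$ be an algebraically closed field of characteristic $p>0$. A matrix $A(T)\in\mathrm{Mat}(n,k[T])$ is called exponential if $A(T)A(T')=A(T+T')$ in $\mathrm{Mat}(n,k[T,T'])$ and $A(0)=I_n$; let $\mathrm{Mat}(n,k[T])^E$ be the set of these matrices. Such an $A(T)$ defines the $\mathbb G_a$-action $\mu_A:\mathbb G_a\times\mathbb P^{n-1}\to\mathbb P^{n-1}$ which sends $t$ and the point with homogeneous coordinate column vector $x$ to the point with coordinates $A(t)x$. For $n\ge 1$, two exponential matrices $A$, $B$ of size $n$ are birationally equivalent, $A\overset{\rm bir}{\sim}B$, if there is a birational transformation $\sigma$ of $\mathbb P^{n-1}$ with $\sigma\circ\mu_A=\mu_B\circ(\mathrm{id}_{\mathbb G_a}\times\sigma)$ as rational maps $\mathbb G_a\times\mathbb P^{n-1}\dashrightarrow\mathbb P^{n-1}$; this is an equivalence relation. Let $\mathsf P\subset k[T]$ be the $k$-vector space of $p$-polynomials $\sum_{i=0}^{e}c_iT^{p^i}$ ($e \geq 0$, $c_i\in k$), and let $(\mathsf P^m)^{\rm indep}$ be the set of $m$-tuples of $p$-polynomials that are linearly independent over $k$,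 so that $(\mathsf P^1)^{\rm indep}=\mathsf P\setminus\{0\}$. For $\alpha,\beta\in(\mathsf P^m)^{\rm indep}$, regarded as row vectors, write $\alpha\sim_{\mathrm{GL}(m,k)}\beta$ if $\alpha=\beta Q$ for some $Q\in\mathrm{GL}(m,k)$. Then there is a well-defined bijection $$\{0\}\ \sqcup\ (\mathsf P\setminus\{0\})/\!\sim_{\mathrm{GL}(1,k)}\ \sqcup\ (\mathsf P^2)^{\rm indep}/\!\sim_{\mathrm{GL}(2,k)}\ \longrightarrow\ \mathrm{Mat}(3,k[T])^E/\overset{\rm bir}{\sim}$$ which sends $0$ to the class of $I_3$, the class of $\alpha$ to the class of $$\begin{pmatrix}1&0&\alpha(T)\\0&1&0\\0&0&1\end{pmatrix},$$ and the class of $(\alpha_1,\alpha_2)$ to the class of $$\begin{pmatrix}1&\alpha_1(T)&\alpha_2(T)\\0&1&0\\0&0&1\end{pmatrix}.$$ -/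

import Mathlib

open Polynomial LinearAlgebra.Projectivization

namespace ExpMatrix

/-! ### Exponential matrices -/

section Exponential

variable {k : Type*} [Field k] {n : ℕ}

/-- A polynomial matrix `A(T)` is exponential if `A(T) A(T') = A(T + T')` in
`Mat(n, k[T, T'])` and `A(0) = I`.  Here `T`, `T'` are the two variables of
`MvPolynomial (Fin 2) k`. -/
def IsExponential (A : Matrix (Fin n) (Fin n) k[X]) : Prop :=
  A.map (aeval (MvPolynomial.X 0 : MvPolynomial (Fin 2) k)) *
      A.map (aeval (MvPolynomial.X 1 : MvPolynomial (Fin 2) k)) =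
    A.map (aeval (MvPolynomial.X 0 + MvPolynomial.X 1 : MvPolynomial (Fin 2) k)) ∧
  A.map (eval 0) = 1

/-- The set `Mat(n, k[T])^E` of exponential matrices. -/
def ExpMat (n : ℕ) (k : Type*) [Field k] : Type _ := {A : Matrix (Fin n) (Fin n) k[X] // IsExponential A}

/-- The value `A(t)` of an exponential matrix at `t ∈ k`. -/
def ExpMat.at (A : ExpMat n k) (t : k) : Matrix (Fin n) (Fin n) k :=
  A.1.map (eval t)

theorem ExpMat.at_add (A : ExpMat n k) (s t : k) : A.at s * A.at t = A.at (s + t) := by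
  have h := congrArg
    (fun M : Matrix (Fin n) (Fin n) (MvPolynomial (Fin 2) k) =>
      M.map (MvPolynomial.eval ![s, t])) A.2.1
  have key : ∀ q : MvPolynomial (Fin 2) k, ∀ P : k[X],
      MvPolynomial.eval ![s, t] (aeval q P) = eval (MvPolynomial.eval ![s, t] q) P := by
    intro q P
    rw [Polynomial.aeval_def, Polynomial.hom_eval₂]
    have : (MvPolynomial.eval ![s, t]).comp (algebraMap k (MvPolynomial (Fin 2) k))
        = RingHom.id k := by
      ext x; simp [MvPolynomial.algebraMap_eq]
    rw [this]; rfl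
  ext i j
  have h' := congrFun (congrFun h i) j
  simp only [Matrix.map_apply, Matrix.mul_apply, map_sum, map_mul, key] at h'
  simpa [ExpMat.at, Matrix.mul_apply] using h'

theorem ExpMat.at_zero (A : ExpMat n k) : A.at 0 = 1 := A.2.2

theorem ExpMat.at_injective (A : ExpMat n k) (t : k) :
    Function.Injective (A.at t).mulVecLin := by
  refine Function.LeftInverse.injective (g := (A.at (-t)).mulVecLin) fun v => ?_
  simp [Matrix.mulVec_mulVec, A.at_add, A.at_zero]

/-- The `𝔾ₐ`-action on `ℙ^{n-1}` attached to an exponential matrix: `t` sends the point with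
homogeneous coordinates `v` (a column vector) to the point with coordinates `A(t) v`. -/
def ExpMat.act (A : ExpMat n k) (t : k) : ℙ k (Fin n → k) → ℙ k (Fin n → k) :=
  Projectivization.map (A.at t).mulVecLin (A.at_injective t)

/-- The identity matrix as an exponential matrix. -/
noncomputable def ExpMat.id : ExpMat n k :=
  ⟨1, by
    constructor
    · simp [Matrix.map_one]
    · simp [Matrix.map_one]⟩

end Exponential

/-! ### The classical projective variety `ℙ^{n-1}`: Zariski topology and regular maps -/

section Projective

variable {k : Type*} [Field k] {n : ℕ}

/-- The set of points of `ℙ^{n-1}` where the polynomial `F` (homogeneous in all uses) does not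
vanish. -/
def nonvanishing (F : MvPolynomial (Fin n) k) : Set (ℙ k (Fin n → k)) :=
  {P | MvPolynomial.eval P.rep F ≠ 0}

/-- Zariski-open subsets of `ℙ^{n-1}`: unions of nonvanishing sets of homogeneous polynomials. -/
def IsZariskiOpen (U : Set (ℙ k (Fin n → k))) : Prop :=
  ∀ P ∈ U, ∃ (d : ℕ) (F : MvPolynomial (Fin n) k),
    F.IsHomogeneous d ∧ P ∈ nonvanishing F ∧ nonvanishing F ⊆ U

/-- `φ` is regular on `U`: Zariski-locally on `U` it is given, in homogeneous coordinates, by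
homogeneous polynomials `f₀, …, fₙ₋₁` of one and the same degree without common zero. -/
def IsRegularOn (φ : ℙ k (Fin n → k) → ℙ k (Fin n → k)) (U : Set (ℙ k (Fin n → k))) : Prop :=
  ∀ P ∈ U, ∃ V : Set (ℙ k (Fin n → k)), IsZariskiOpen V ∧ P ∈ V ∧
    ∃ (d : ℕ) (f : Fin n → MvPolynomial (Fin n) k), (∀ i, (f i).IsHomogeneous d) ∧
      ∀ (v : Fin n → k) (hv : v ≠ 0), Projectivization.mk k v hv ∈ U ∩ V →
        ∃ hw : (fun i => MvPolynomial.eval v (f i)) ≠ 0,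
          φ (Projectivization.mk k v hv) =
            Projectivization.mk k (fun i => MvPolynomial.eval v (f i)) hw

/-- A birational transformation of `ℙ^{n-1}`, presented as an isomorphism of varieties
between two nonempty Zariski-open subsets (the source and the target of `σ`). -/
structure IsBirational (σ : PartialEquiv (ℙ k (Fin n → k)) (ℙ k (Fin n → k))) : Prop where
  isOpen_source : IsZariskiOpen σ.source
  isOpen_target : IsZariskiOpen σ.target
  nonempty : σ.source.Nonempty
  regular : IsRegularOn σ σ.source
  regular_symm : IsRegularOn σ.symm σ.target

/-- Birational equivalence of exponential matrices: some birational transformation `σ` of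
`ℙ^{n-1}` satisfies `σ ∘ μ_A = μ_B ∘ (id × σ)` as rational maps `𝔾ₐ × ℙ^{n-1} ⇢ ℙ^{n-1}`, that is,
the two sides agree on the nonempty open set of all `(t, P)` with `P` and `μ_A(t, P)` in the domain
of `σ`. -/
def BirEquiv (A B : ExpMat n k) : Prop :=
  ∃ σ : PartialEquiv (ℙ k (Fin n → k)) (ℙ k (Fin n → k)), IsBirational σ ∧
    ∀ (t : k) (P : ℙ k (Fin n → k)), P ∈ σ.source → A.act t P ∈ σ.source →
      σ (A.act t P) = B.act t (σ P)

theorem eval_smul_of_homogeneous {F : MvPolynomial (Fin n) k} {d : ℕ} (hF : F.IsHomogeneous d)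
    (c : k) (v : Fin n → k) :
    MvPolynomial.eval (c • v) F = c ^ d * MvPolynomial.eval v F := by
  rw [MvPolynomial.eval_eq', MvPolynomial.eval_eq', Finset.mul_sum]
  refine Finset.sum_congr rfl fun m hm => ?_
  have hd : ∑ i, m i = d := by
    have := hF (MvPolynomial.mem_support_iff.mp hm)
    rw [← this, Finsupp.weight_apply, Finsupp.sum_fintype _ _ (by simp)]
    simp
  simp only [Pi.smul_apply, smul_eq_mul, mul_pow, Finset.prod_mul_distrib,
    Finset.prod_pow_eq_pow_sum, hd]
  ring

theorem mk_mem_nonvanishing {F : MvPolynomial (Fin n) k} {d : ℕ} (hF : F.IsHomogeneous d)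
    (v : Fin n → k) (hv : v ≠ 0) :
    Projectivization.mk k v hv ∈ nonvanishing F ↔ MvPolynomial.eval v F ≠ 0 := by
  obtain ⟨a, ha⟩ := Projectivization.exists_smul_eq_mk_rep k v hv
  have ha' : (Projectivization.mk k v hv).rep = (a : k) • v := ha.symm
  simp only [nonvanishing, Set.mem_ofPred_eq, ha', eval_smul_of_homogeneous hF]
  simp

theorem isZariskiOpen_univ : IsZariskiOpen (Set.univ : Set (ℙ k (Fin n → k))) := fun P _ =>
  ⟨0, 1, MvPolynomial.isHomogeneous_one _ _, by simp [nonvanishing], Set.subset_univ _⟩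

theorem isZariskiOpen_nonvanishing {F : MvPolynomial (Fin n) k} {d : ℕ}
    (hF : F.IsHomogeneous d) : IsZariskiOpen (nonvanishing F) := fun _ hP =>
  ⟨d, F, hF, hP, subset_rfl⟩

theorem IsZariskiOpen.inter {U V : Set (ℙ k (Fin n → k))} (hU : IsZariskiOpen U)
    (hV : IsZariskiOpen V) : IsZariskiOpen (U ∩ V) := by
  rintro P ⟨hPU, hPV⟩
  obtain ⟨d, F, hF, hPF, hFU⟩ := hU P hPU
  obtain ⟨e, G, hG, hPG, hGV⟩ := hV P hPV
  refine ⟨d + e, F * G, hF.mul hG, ?_, fun Q hQ => ?_⟩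
  · simp only [nonvanishing, Set.mem_ofPred_eq, map_mul] at *
    exact mul_ne_zero hPF hPG
  · simp only [nonvanishing, Set.mem_ofPred_eq, map_mul] at hQ
    exact ⟨hFU (left_ne_zero_of_mul hQ), hGV (right_ne_zero_of_mul hQ)⟩

theorem ne_zero_of_mem_nonvanishing {F : MvPolynomial (Fin n) k} {P : ℙ k (Fin n → k)}
    (h : P ∈ nonvanishing F) : F ≠ 0 := by
  rintro rfl
  simp [nonvanishing] at h

theorem exists_coord (P : ℙ k (Fin n → k)) :
    ∃ i, P ∈ nonvanishing (MvPolynomial.X i : MvPolynomial (Fin n) k) := by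
  by_contra! h
  apply P.rep_nonzero
  ext i
  simpa [nonvanishing] using h i

/-- `ℙ^{n-1}` is irreducible. -/
theorem IsZariskiOpen.inter_nonempty [Infinite k] {U V : Set (ℙ k (Fin n → k))}
    (hU : IsZariskiOpen U) (hV : IsZariskiOpen V) (hU' : U.Nonempty) (hV' : V.Nonempty) :
    (U ∩ V).Nonempty := by
  obtain ⟨P, hP⟩ := hU'
  obtain ⟨Q, hQ⟩ := hV'
  obtain ⟨d, F, hF, hPF, hFU⟩ := hU P hP
  obtain ⟨e, G, hG, hQG, hGV⟩ := hV Q hQ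
  obtain ⟨i, hi⟩ := exists_coord P
  have hne : F * G * MvPolynomial.X i ≠ 0 :=
    mul_ne_zero (mul_ne_zero (ne_zero_of_mem_nonvanishing hPF) (ne_zero_of_mem_nonvanishing hQG))
      (ne_zero_of_mem_nonvanishing hi)
  have : ∃ v : Fin n → k, MvPolynomial.eval v (F * G * MvPolynomial.X i) ≠ 0 := by
    by_contra! h
    exact hne (MvPolynomial.funext fun v => by simpa using h v)
  obtain ⟨v, hv⟩ := this
  simp only [map_mul, MvPolynomial.eval_X] at hv
  have hv0 : v ≠ 0 := by
    rintro rfl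
    simp at hv
  refine ⟨Projectivization.mk k v hv0, hFU ?_, hGV ?_⟩
  · exact (mk_mem_nonvanishing hF v hv0).2 (left_ne_zero_of_mul (left_ne_zero_of_mul hv))
  · exact (mk_mem_nonvanishing hG v hv0).2 (right_ne_zero_of_mul (left_ne_zero_of_mul hv))

theorem IsRegularOn.mono {φ : ℙ k (Fin n → k) → ℙ k (Fin n → k)} {U U' : Set (ℙ k (Fin n → k))}
    (h : IsRegularOn φ U) (hU : U' ⊆ U) : IsRegularOn φ U' := by
  intro P hP
  obtain ⟨V, hV, hPV, d, f, hf, hfV⟩ := h P (hU hP)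
  exact ⟨V, hV, hPV, d, f, hf, fun v hv hm => hfV v hv ⟨hU hm.1, hm.2⟩⟩

theorem isRegularOn_id (U : Set (ℙ k (Fin n → k))) : IsRegularOn _root_.id U := fun P _ =>
  ⟨Set.univ, isZariskiOpen_univ, trivial, 1, MvPolynomial.X, MvPolynomial.isHomogeneous_X k,
    fun v hv _ => by simpa using hv⟩

theorem eval_bind {d e : ℕ} {f : Fin n → MvPolynomial (Fin n) k} {G : MvPolynomial (Fin n) k}
    (hf : ∀ i, (f i).IsHomogeneous d) (hG : G.IsHomogeneous e) :
    (MvPolynomial.bind₁ f G).IsHomogeneous (d * e) ∧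
      ∀ v, MvPolynomial.eval v (MvPolynomial.bind₁ f G) =
        MvPolynomial.eval (fun i => MvPolynomial.eval v (f i)) G := by
  refine ⟨hG.aeval f hf, fun v => ?_⟩
  have := MvPolynomial.eval₂Hom_bind₁ (RingHom.id k) v f G
  exact this

/-- Regular maps are continuous for the Zariski topology. -/
theorem IsRegularOn.isZariskiOpen_preimage {φ : ℙ k (Fin n → k) → ℙ k (Fin n → k)}
    {U W : Set (ℙ k (Fin n → k))} (h : IsRegularOn φ U) (hU : IsZariskiOpen U)
    (hW : IsZariskiOpen W) : IsZariskiOpen (U ∩ φ ⁻¹' W) := by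
  rintro P ⟨hPU, hPW⟩
  obtain ⟨V, hV, hPV, d, f, hf, hfV⟩ := h P hPU
  obtain ⟨e, G, hG, hPG, hGW⟩ := hW _ hPW
  obtain ⟨a, F, hF, hPF, hFU⟩ := (hU.inter hV) P ⟨hPU, hPV⟩
  obtain ⟨hB, hBe⟩ := eval_bind hf hG
  refine ⟨_, F * MvPolynomial.bind₁ f G, hF.mul hB, ?_, ?_⟩
  · induction P using Projectivization.ind with
    | h v hv =>
      obtain ⟨hw, hφ⟩ := hfV v hv ⟨hPU, hPV⟩
      rw [hφ, mk_mem_nonvanishing hG] at hPG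
      rw [mk_mem_nonvanishing hF] at hPF
      rw [mk_mem_nonvanishing (hF.mul hB), map_mul, hBe]
      exact mul_ne_zero hPF hPG
  · intro Q hQ
    induction Q using Projectivization.ind with
    | h v hv =>
      rw [mk_mem_nonvanishing (hF.mul hB), map_mul, hBe] at hQ
      have hm := hFU ((mk_mem_nonvanishing hF v hv).2 (left_ne_zero_of_mul hQ))
      obtain ⟨hw, hφ⟩ := hfV v hv hm
      refine ⟨hm.1, hGW ?_⟩
      rw [hφ, mk_mem_nonvanishing hG]
      exact right_ne_zero_of_mul hQ

theorem IsRegularOn.comp {φ ψ : ℙ k (Fin n → k) → ℙ k (Fin n → k)}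
    {U W : Set (ℙ k (Fin n → k))} (hψ : IsRegularOn ψ W) (hφ : IsRegularOn φ U)
    (hU : IsZariskiOpen U) : IsRegularOn (ψ ∘ φ) (U ∩ φ ⁻¹' W) := by
  rintro P ⟨hPU, hPW⟩
  obtain ⟨V, hV, hPV, d, f, hf, hfV⟩ := hφ P hPU
  obtain ⟨V', hV', hPV', e, g, hg, hgV⟩ := hψ _ hPW
  refine ⟨V ∩ (U ∩ φ ⁻¹' V'), hV.inter (hφ.isZariskiOpen_preimage hU hV'), ⟨hPV, hPU, hPV'⟩,
    d * e, fun i => MvPolynomial.bind₁ f (g i), fun i => (eval_bind hf (hg i)).1, ?_⟩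
  rintro v hv ⟨⟨h1, h2⟩, h3, -, h4⟩
  obtain ⟨hw, hφv⟩ := hfV v hv ⟨h1, h3⟩
  simp only [Set.mem_preimage, hφv] at h2 h4
  obtain ⟨hz, hψv⟩ := hgV _ hw ⟨h2, h4⟩
  have hE : ∀ i, MvPolynomial.eval v (MvPolynomial.bind₁ f (g i)) =
      MvPolynomial.eval (fun i => MvPolynomial.eval v (f i)) (g i) :=
    fun i => (eval_bind hf (hg i)).2 v
  simp only [hE, Function.comp_apply, hφv]
  exact ⟨hz, hψv⟩

theorem isRegularOn_act (A : ExpMat n k) (t : k) : IsRegularOn (A.act t) Set.univ := by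
  intro P _
  refine ⟨Set.univ, isZariskiOpen_univ, trivial, 1,
    fun i => ∑ j, MvPolynomial.C (A.at t i j) * MvPolynomial.X j, fun i => ?_, ?_⟩
  · exact MvPolynomial.IsHomogeneous.sum _ _ _ fun j _ =>
      MvPolynomial.isHomogeneous_C_mul_X _ _
  · intro v hv _
    have hE : (fun i => MvPolynomial.eval v
        (∑ j, MvPolynomial.C (A.at t i j) * MvPolynomial.X j)) = (A.at t).mulVecLin v := by
      ext i
      simp [Matrix.mulVec, dotProduct]
    simp only [hE]
    exact ⟨fun h0 => hv (A.at_injective t (by simpa using h0)), rfl⟩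

theorem mk_eq_mk_of_minors {v w : Fin n → k} (hv : v ≠ 0) (hw : w ≠ 0)
    (h : ∀ i j, v i * w j = v j * w i) :
    Projectivization.mk k v hv = Projectivization.mk k w hw := by
  obtain ⟨i, hi⟩ := Function.ne_iff.mp hw
  rw [Projectivization.mk_eq_mk_iff']
  refine ⟨v i / w i, ?_⟩
  ext j
  simp only [Pi.zero_apply] at hi
  simp only [Pi.smul_apply, smul_eq_mul]
  rw [div_mul_eq_mul_div, div_eq_iff hi, h i j]

/-- Regular maps that agree on a nonempty open subset agree. -/
theorem IsRegularOn.eqOn [Infinite k] {φ ψ : ℙ k (Fin n → k) → ℙ k (Fin n → k)}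
    {U W : Set (ℙ k (Fin n → k))} (hφ : IsRegularOn φ U) (hψ : IsRegularOn ψ U)
    (hU : IsZariskiOpen U) (hW : IsZariskiOpen W) (hW' : W.Nonempty)
    (h : ∀ P ∈ U ∩ W, φ P = ψ P) {P : ℙ k (Fin n → k)} (hP : P ∈ U) : φ P = ψ P := by
  obtain ⟨V, hV, hPV, d, f, hf, hfV⟩ := hφ P hP
  obtain ⟨V', hV', hPV', e, g, hg, hgV⟩ := hψ P hP
  have hO : IsZariskiOpen (U ∩ (V ∩ V')) := hU.inter (hV.inter hV')
  obtain ⟨Q, hQ⟩ := hO.inter_nonempty hW ⟨P, hP, hPV, hPV'⟩ hW'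
  obtain ⟨a, F, hF, hQF, hFU⟩ := (hO.inter hW) Q hQ
  obtain ⟨l, hl⟩ := exists_coord Q
  have key : ∀ i j, f i * g j = f j * g i := by
    intro i j
    have h0 : F * MvPolynomial.X l * (f i * g j - f j * g i) = 0 := by
      refine MvPolynomial.funext fun v => ?_
      simp only [map_mul, map_sub, MvPolynomial.eval_X, map_zero]
      by_cases hv : v = 0
      · simp [hv]
      by_cases hFv : MvPolynomial.eval v F = 0
      · simp [hFv]
      obtain ⟨⟨h1, h2, h3⟩, h4⟩ := hFU ((mk_mem_nonvanishing hF v hv).2 hFv)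
      obtain ⟨hw, hφv⟩ := hfV v hv ⟨h1, h2⟩
      obtain ⟨hz, hψv⟩ := hgV v hv ⟨h1, h3⟩
      have := h _ ⟨h1, h4⟩
      rw [hφv, hψv, Projectivization.mk_eq_mk_iff'] at this
      obtain ⟨c, hc⟩ := this
      have hi := congrFun hc i
      have hj := congrFun hc j
      simp only [Pi.smul_apply, smul_eq_mul] at hi hj
      rw [← hi, ← hj]
      ring
    rcases mul_eq_zero.mp h0 with h1 | h1
    · exact absurd h1
        (mul_ne_zero (ne_zero_of_mem_nonvanishing hQF) (ne_zero_of_mem_nonvanishing hl))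
    · exact sub_eq_zero.mp h1
  induction P using Projectivization.ind with
  | h v hv =>
    obtain ⟨hw, hφv⟩ := hfV v hv ⟨hP, hPV⟩
    obtain ⟨hz, hψv⟩ := hgV v hv ⟨hP, hPV'⟩
    rw [hφv, hψv]
    refine mk_eq_mk_of_minors hw hz fun i j => ?_
    rw [← map_mul, ← map_mul, key i j]

theorem IsBirational.refl [NeZero n] :
    IsBirational (PartialEquiv.refl (ℙ k (Fin n → k))) where
  isOpen_source := isZariskiOpen_univ
  isOpen_target := isZariskiOpen_univ
  nonempty := ⟨Projectivization.mk k 1 one_ne_zero, trivial⟩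
  regular := isRegularOn_id _
  regular_symm := isRegularOn_id _

theorem IsBirational.symm {σ : PartialEquiv (ℙ k (Fin n → k)) (ℙ k (Fin n → k))}
    (h : IsBirational σ) : IsBirational σ.symm where
  isOpen_source := h.isOpen_target
  isOpen_target := h.isOpen_source
  nonempty := h.nonempty.elim fun P hP => ⟨σ P, σ.map_source hP⟩
  regular := h.regular_symm
  regular_symm := h.regular

theorem IsBirational.trans [Infinite k]
    {σ τ : PartialEquiv (ℙ k (Fin n → k)) (ℙ k (Fin n → k))}
    (hσ : IsBirational σ) (hτ : IsBirational τ) : IsBirational (σ.trans τ) where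
  isOpen_source := by
    rw [PartialEquiv.trans_source]
    exact hσ.regular.isZariskiOpen_preimage hσ.isOpen_source hτ.isOpen_source
  isOpen_target := by
    rw [PartialEquiv.trans_target]
    exact hτ.regular_symm.isZariskiOpen_preimage hτ.isOpen_target hσ.isOpen_target
  nonempty := by
    obtain ⟨Q, hQ, hQ'⟩ := hσ.isOpen_target.inter_nonempty hτ.isOpen_source
      hσ.symm.nonempty hτ.nonempty
    refine ⟨σ.symm Q, ?_⟩
    rw [PartialEquiv.trans_source]
    exact ⟨σ.map_target hQ, by simpa [σ.right_inv hQ] using hQ'⟩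
  regular := by
    rw [PartialEquiv.trans_source]
    exact hτ.regular.comp hσ.regular hσ.isOpen_source
  regular_symm := by
    rw [PartialEquiv.trans_target]
    exact hσ.regular_symm.comp hτ.regular_symm hτ.isOpen_target

theorem BirEquiv.refl [NeZero n] (A : ExpMat n k) : BirEquiv A A :=
  ⟨PartialEquiv.refl _, IsBirational.refl, fun _ _ _ _ => rfl⟩

theorem BirEquiv.symm [Infinite k] {A B : ExpMat n k} (h : BirEquiv A B) : BirEquiv B A := by
  obtain ⟨σ, hσ, hc⟩ := h
  refine ⟨σ.symm, hσ.symm, fun t Q hQ hBQ => ?_⟩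
  simp only [PartialEquiv.symm_source] at hQ hBQ
  have hAopen : ∀ {U : Set (ℙ k (Fin n → k))}, IsZariskiOpen U →
      IsZariskiOpen (Set.univ ∩ A.act t ⁻¹' U) := fun hU =>
    (isRegularOn_act A t).isZariskiOpen_preimage isZariskiOpen_univ hU
  have hBopen : ∀ {U : Set (ℙ k (Fin n → k))}, IsZariskiOpen U →
      IsZariskiOpen (Set.univ ∩ B.act t ⁻¹' U) := fun hU =>
    (isRegularOn_act B t).isZariskiOpen_preimage isZariskiOpen_univ hU
  have hsurj : (Set.univ ∩ A.act t ⁻¹' σ.source).Nonempty := by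
    obtain ⟨P, hP⟩ := hσ.nonempty
    refine ⟨A.act (-t) P, trivial, ?_⟩
    have : A.act t (A.act (-t) P) = P := by
      induction P using Projectivization.ind with
      | h v hv =>
        simp [ExpMat.act, Projectivization.map_mk, Matrix.mulVec_mulVec, A.at_add, A.at_zero]
    simpa [this] using hP
  -- points `Q` of the target with `μ_A(t, σ⁻¹ Q)` in the source
  set W := σ.target ∩ σ.symm ⁻¹' (σ.source ∩ (Set.univ ∩ A.act t ⁻¹' σ.source)) with hWdef
  have hW : IsZariskiOpen W := hσ.regular_symm.isZariskiOpen_preimage hσ.isOpen_target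
    (hσ.isOpen_source.inter (hAopen hσ.isOpen_source))
  have hW' : W.Nonempty := by
    obtain ⟨P, hP⟩ := hσ.isOpen_source.inter_nonempty (hAopen hσ.isOpen_source)
      hσ.nonempty hsurj
    refine ⟨σ P, σ.map_source hP.1, ?_⟩
    simpa [σ.left_inv hP.1] using hP
  have hU : IsZariskiOpen (σ.target ∩ (Set.univ ∩ B.act t ⁻¹' σ.target)) :=
    hσ.isOpen_target.inter (hBopen hσ.isOpen_target)
  have h1 : IsRegularOn (σ.symm ∘ B.act t) (σ.target ∩ (Set.univ ∩ B.act t ⁻¹' σ.target)) :=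
    (hσ.regular_symm.comp (isRegularOn_act B t) isZariskiOpen_univ).mono Set.inter_subset_right
  have h2 : IsRegularOn (A.act t ∘ σ.symm) (σ.target ∩ (Set.univ ∩ B.act t ⁻¹' σ.target)) :=
    ((isRegularOn_act A t).comp hσ.regular_symm hσ.isOpen_target).mono
      fun x hx => ⟨hx.1, trivial⟩
  refine h1.eqOn h2 hU hW hW' ?_ ⟨hQ, trivial, hBQ⟩
  rintro R ⟨-, hR, hR1, -, hR2⟩
  have := hc t (σ.symm R) hR1 hR2
  rw [σ.right_inv hR] at this
  simp only [Function.comp_apply]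
  rw [← this]
  exact σ.left_inv hR2

theorem BirEquiv.trans [Infinite k] {A B C : ExpMat n k} (h : BirEquiv A B)
    (h' : BirEquiv B C) : BirEquiv A C := by
  obtain ⟨σ, hσ, hc⟩ := h
  obtain ⟨τ, hτ, hc'⟩ := h'
  refine ⟨σ.trans τ, hσ.trans hτ, fun t P hP hAP => ?_⟩
  rw [PartialEquiv.trans_source] at hP hAP
  have h1 := hc t P hP.1 hAP.1
  have h2 : σ (A.act t P) ∈ τ.source := hAP.2
  simp only [PartialEquiv.coe_trans, Function.comp_apply]
  rw [h1] at h2 ⊢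
  exact hc' t (σ P) hP.2 h2

/-- Birational equivalence as an equivalence relation on `Mat(n, k[T])^E`, for `n ≥ 1`. -/
instance birSetoid (n : ℕ) [NeZero n] (k : Type*) [Field k] [IsAlgClosed k] :
    Setoid (ExpMat n k) where
  r := BirEquiv
  iseqv :=
    haveI : Infinite k := IsAlgClosed.instInfinite
    ⟨BirEquiv.refl, BirEquiv.symm, BirEquiv.trans⟩

end Projective

/-! ### `p`-polynomials and the standard forms -/

section PPolynomials

/-- The `p`-polynomials: the polynomials `∑ cᵢ T^(pⁱ)` with coefficients in `k`. -/
noncomputable def pPoly (p : ℕ) (k : Type*) [Field k] : Submodule k k[X] :=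
  Submodule.span k (Set.range fun i : ℕ => (X : k[X]) ^ p ^ i)

/-- The set `(P^m)^indep` of `m`-tuples of `p`-polynomials that are linearly independent over `k`.
For `m = 1` this is the set of nonzero `p`-polynomials. -/
def IndepTuple (p : ℕ) (k : Type*) [Field k] (m : ℕ) : Type _ :=
  {a : Fin m → pPoly p k // LinearIndependent k a}

/-- `GL(m, k)`-equivalence of independent tuples: the row vectors satisfy `a = b Q` for some
`Q ∈ GL(m, k)`. -/
def GLEquiv {p : ℕ} {k : Type*} [Field k] {m : ℕ} (a b : IndepTuple p k m) : Prop :=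
  ∃ Q : GL (Fin m) k, ∀ j, a.1 j = ∑ i, Q.1 i j • b.1 i

instance glSetoid (p : ℕ) (k : Type*) [Field k] (m : ℕ) : Setoid (IndepTuple p k m) where
  r := GLEquiv
  iseqv := by
    have htrans : ∀ {a b c : IndepTuple p k m} {Q R : Matrix (Fin m) (Fin m) k},
        (∀ j, a.1 j = ∑ i, Q i j • b.1 i) → (∀ j, b.1 j = ∑ i, R i j • c.1 i) →
        ∀ j, a.1 j = ∑ i, (R * Q) i j • c.1 i := by
      intro a b c Q R h h' j
      simp only [h, h', Matrix.mul_apply, Finset.smul_sum, Finset.sum_smul, smul_smul]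
      rw [Finset.sum_comm]
      simp only [mul_comm]
    refine ⟨fun a => ⟨1, fun j => ?_⟩, ?_, ?_⟩
    · simp [Matrix.one_apply]
    · rintro a b ⟨Q, hQ⟩
      refine ⟨Q⁻¹, fun j => ?_⟩
      have : ∀ j, b.1 j = ∑ i, (1 : Matrix (Fin m) (Fin m) k) i j • b.1 i := by
        simp [Matrix.one_apply]
      rw [this j, ← Units.mul_inv Q]
      simp only [hQ, Matrix.mul_apply, Finset.smul_sum, Finset.sum_smul, smul_smul]
      rw [Finset.sum_comm]
      simp only [mul_comm]
    · rintro a b c ⟨Q, hQ⟩ ⟨R, hR⟩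
      exact ⟨R * Q, htrans hQ hR⟩

variable {p : ℕ} {k : Type*} [Field k] [Fact p.Prime] [CharP k p]

/-- `p`-polynomials are additive. -/
theorem aeval_add_of_mem_pPoly {R : Type*} [CommRing R] [Algebra k R] {α : k[X]}
    (hα : α ∈ pPoly p k) (x y : R) : aeval (x + y) α = aeval x α + aeval y α := by
  nontriviality R
  have : CharP R p := charP_of_injective_algebraMap (algebraMap k R).injective p
  induction hα using Submodule.span_induction with
  | mem a ha =>
    obtain ⟨i, rfl⟩ := ha
    simp [add_pow_char_pow]
  | zero => simp
  | add a b _ _ iha ihb => rw [map_add, map_add, map_add, iha, ihb]; ring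
  | smul c a _ iha => rw [map_smul, map_smul, map_smul, iha, smul_add]

theorem eval_zero_of_mem_pPoly {α : k[X]} (hα : α ∈ pPoly p k) : eval 0 α = 0 := by
  have h := aeval_add_of_mem_pPoly (p := p) hα (0 : k) 0
  simpa [Polynomial.coe_aeval_eq_eval] using h

/-- The exponential matrix with rows `(1, α₁, α₂)`, `(0, 1, 0)`, `(0, 0, 1)`, for
`p`-polynomials `α₁, α₂`. -/
noncomputable def matA12 (α₁ α₂ : pPoly p k) : ExpMat 3 k :=
  ⟨!![1, (α₁ : k[X]), (α₂ : k[X]); 0, 1, 0; 0, 0, 1], by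
    constructor
    · ext1 i j
      fin_cases i <;> fin_cases j <;>
        simp [Matrix.mul_apply, Fin.sum_univ_three, aeval_add_of_mem_pPoly α₁.2,
          aeval_add_of_mem_pPoly α₂.2, add_comm]
    · ext1 i j
      fin_cases i <;> fin_cases j <;>
        simp [eval_zero_of_mem_pPoly α₁.2, eval_zero_of_mem_pPoly α₂.2]⟩

/-- The exponential matrix with rows `(1, 0, α)`, `(0, 1, 0)`, `(0, 0, 1)`, for a
`p`-polynomial `α`. -/
noncomputable def matA11 (α : pPoly p k) : ExpMat 3 k :=
  ⟨!![1, 0, (α : k[X]); 0, 1, 0; 0, 0, 1], by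
    constructor
    · ext1 i j
      fin_cases i <;> fin_cases j <;>
        simp [Matrix.mul_apply, Fin.sum_univ_three, aeval_add_of_mem_pPoly α.2, add_comm]
    · ext1 i j
      fin_cases i <;> fin_cases j <;>
        simp [eval_zero_of_mem_pPoly α.2]⟩

end PPolynomials

end ExpMatrix

/-!
The invariant behind the classification is the subspace spanned by `α₁, α₂` in the space of
`p`-polynomials, for the matrix `matA12 α₁ α₂` with rows `(1, α₁, α₂)`, `(0, 1, 0)`, `(0, 0, 1)`.
All normal forms are of this kind: `matA11 α = matA12 0 α` and the identity is `matA12 0 0`.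

*The span is a birational invariant* (`span_le_of_birEquiv`).  In the chart `(u : v : 1)` the
element `t` acts on the line `v = v₀` as the translation by `α(t)`, with `α = v₀ α₁ + α₂`.  An
equivariant birational map takes the orbit of a general point of this line to an orbit
`(u₁ + β(t) : v₁ : 1)` with `β = v₁ β₁ + β₂`.  As the map is given by polynomials along the line,
`β` is a rational function of `α`, hence a polynomial in `α`, because coprime polynomials remain
coprime after composition with `α` (`exists_eq_comp`).  The same holds with `α` and `β` exchanged, so that they are
proportional, and `α` is in the span of `β₁, β₂`.  Two values of `v₀` suffice for `α₁` and `α₂`.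
Independent tuples with the same span differ by an element of `GL(m, k)`, and conversely such an
element gives a linear conjugation; so the map from the normal forms is well defined and injective.

*Every exponential matrix is equivalent to some `matA12 α₁ α₂`* (`exists_birEquiv_matA12`).  The
coefficient matrix of top degree of a nonconstant `A(T)` is fixed by `A(t)` on both sides and has
square zero; a column and a row of it give a basis in which `A(T)` is unitriangular, with entries
`a`, `b` above the diagonal and `c` in the corner.  If `b = 0` this is a `matA12`.  Otherwise `a`
is a multiple of `b`, and a shear `(u, v) ↦ (u - μ v², v)` turns the action into one by
translations `(u + c'(t), v + b(t))`.  Shears `(u, v) ↦ (u - x v^(p^e), v)` and the swap of `u`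
and `v` perform the Euclidean algorithm for `p`-polynomials under composition on the pair
`(c', b)` and end with a translation in one coordinate (`translation_birEquiv`).
-/

namespace ExpMatrix

open scoped Matrix

/-! ### Additive polynomials -/

section Additive

variable {p : ℕ} {k : Type*} [Field k]

theorem eval_add_of_mem_pPoly [Fact p.Prime] [CharP k p] {f : k[X]} (hf : f ∈ pPoly p k)
    (s t : k) : f.eval (s + t) = f.eval s + f.eval t := by
  simpa [Polynomial.coe_aeval_eq_eval] using aeval_add_of_mem_pPoly (p := p) hf s t

theorem expand_mem_pPoly {f : k[X]} (hf : f ∈ pPoly p k) : expand k p f ∈ pPoly p k := by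
  induction hf using Submodule.span_induction with
  | mem a ha =>
    obtain ⟨i, rfl⟩ := ha
    refine Submodule.subset_span ⟨i + 1, ?_⟩
    simp [← pow_mul, pow_succ']
  | zero => simp
  | add a b _ _ iha ihb => rw [map_add]; exact add_mem iha ihb
  | smul c a _ iha => rw [map_smul]; exact Submodule.smul_mem _ _ iha

/-- The exponents of a `p`-polynomial are powers of `p`. -/
theorem exists_eq_pow_of_coeff_ne_zero {f : k[X]} (hf : f ∈ pPoly p k) {n : ℕ}
    (hn : f.coeff n ≠ 0) : ∃ m, n = p ^ m := by
  induction hf using Submodule.span_induction with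
  | mem a ha =>
    obtain ⟨i, rfl⟩ := ha
    simp only [coeff_X_pow, ne_eq, ite_eq_right_iff, one_ne_zero, imp_false, not_not] at hn
    exact ⟨i, hn⟩
  | zero => simp at hn
  | add a b _ _ iha ihb =>
    rw [coeff_add] at hn
    by_cases h : a.coeff n = 0
    · exact ihb (by simpa [h] using hn)
    · exact iha h
  | smul c a _ iha => exact iha (right_ne_zero_of_mul (by simpa using hn))

theorem exists_natDegree_eq_pow {f : k[X]} (hf : f ∈ pPoly p k) (h0 : f ≠ 0) :
    ∃ m, f.natDegree = p ^ m :=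
  exists_eq_pow_of_coeff_ne_zero hf (by simpa using h0)

theorem natDegree_pos_of_ne_zero [Fact p.Prime] {a : pPoly p k} (ha : a ≠ 0) :
    0 < (a : k[X]).natDegree := by
  obtain ⟨m, hm⟩ := exists_natDegree_eq_pow a.2 (by simpa using ha)
  rw [hm]
  exact pow_pos (Fact.out : p.Prime).pos m

/-- A polynomial that is additive as a function on `k` is a `p`-polynomial: its derivative is
constant, so up to a linear term it is `g(T^p)` with `g` additive of smaller degree. -/
theorem mem_pPoly_of_eval_add [Fact p.Prime] [CharP k p] [IsAlgClosed k] {f : k[X]}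
    (hf : ∀ s t, f.eval (s + t) = f.eval s + f.eval t) : f ∈ pPoly p k := by
  have hp : p.Prime := Fact.out
  have : Infinite k := IsAlgClosed.instInfinite
  induction hd : f.natDegree using Nat.strong_induction_on generalizing f with
  | _ d ih =>
    subst hd
    have hXmem : (X : k[X]) ∈ pPoly p k := Submodule.subset_span ⟨0, by simp⟩
    set c := (derivative f).eval 0 with hc
    have hder : derivative f = C c := by
      refine Polynomial.funext fun t => ?_
      have h1 : f.comp (X + C t) = f + C (f.eval t) :=
        Polynomial.funext fun s => by simp [hf]
      have h2 := congrArg (fun q => (derivative q).eval 0) h1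
      simpa [derivative_comp] using h2
    set g := f - c • (X : k[X]) with hg
    have hg' : derivative g = 0 := by simp [hg, hder, smul_eq_C_mul]
    have hgadd : ∀ s t, g.eval (s + t) = g.eval s + g.eval t := fun s t => by
      simp only [hg, eval_sub, eval_smul, eval_X, hf, smul_eq_mul]; ring
    suffices hgm : g ∈ pPoly p k by
      have : f = g + c • (X : k[X]) := by simp [hg]
      rw [this]
      exact add_mem hgm (Submodule.smul_mem _ _ hXmem)
    have hexp := expand_contract p hg' hp.ne_zero
    rw [← hexp]
    apply expand_mem_pPoly
    have hcadd : ∀ s t, (contract p g).eval (s + t) =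
        (contract p g).eval s + (contract p g).eval t := fun s t => by
      obtain ⟨s, rfl⟩ := IsAlgClosed.exists_pow_nat_eq s hp.pos
      obtain ⟨t, rfl⟩ := IsAlgClosed.exists_pow_nat_eq t hp.pos
      rw [← add_pow_char, ← expand_eval, ← expand_eval, ← expand_eval, hexp, hgadd]
    by_cases h0 : (contract p g).natDegree = 0
    · rw [natDegree_eq_zero] at h0
      obtain ⟨a, ha⟩ := h0
      have := hcadd 0 0
      rw [← ha] at this ⊢
      simp only [eval_C, left_eq_add] at this
      simp [this]
    · refine ih _ ?_ hcadd rfl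
      have h1 : g.natDegree = (contract p g).natDegree * p := by
        conv_lhs => rw [← hexp, natDegree_expand]
      have h2 : 2 ≤ p := hp.two_le
      have h3 : g.natDegree ≤ f.natDegree := by
        -- a degree drop from `f` to `g` can only happen in degree at most one
        by_contra! hlt
        have h4 : g.natDegree ≤ max f.natDegree 1 :=
          (natDegree_sub_le _ _).trans (max_le_max le_rfl
            ((natDegree_smul_le _ _).trans natDegree_X_le))
        rcases le_max_iff.1 h4 with h4 | h4
        · omega
        · have : 2 ≤ g.natDegree := by rw [h1]; nlinarith [Nat.pos_of_ne_zero h0]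
          omega
      have : (contract p g).natDegree < g.natDegree := by
        rw [h1]; nlinarith [Nat.pos_of_ne_zero h0]
      omega

theorem mem_pPoly_iff [Fact p.Prime] [CharP k p] [IsAlgClosed k] {f : k[X]} :
    f ∈ pPoly p k ↔ ∀ s t, f.eval (s + t) = f.eval s + f.eval t :=
  ⟨eval_add_of_mem_pPoly, mem_pPoly_of_eval_add⟩

end Additive

/-! ### Polynomials in one another -/

section Composition

variable {k : Type*} [Field k]

/-- If `Q(α) β = P(α)` with `Q ≠ 0`, then `β` is a polynomial in `α`: for coprime `P`, `Q` the
polynomials `P(α)`, `Q(α)` are coprime, so that `Q(α)` is a unit. -/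
theorem exists_eq_comp {α β P Q : k[X]} (hα : 0 < α.natDegree) (hQ : Q ≠ 0)
    (h : Q.comp α * β = P.comp α) : ∃ D : k[X], β = D.comp α := by
  classical
  obtain ⟨P', Q', hcop, hP', hQ'⟩ :
      ∃ P' Q' : k[X], IsCoprime P' Q' ∧ P = gcd P Q * P' ∧ Q = gcd P Q * Q' := by
    obtain ⟨P', hP'⟩ := gcd_dvd_left P Q
    obtain ⟨Q', hQ'⟩ := gcd_dvd_right P Q
    have hg : gcd P Q ≠ 0 := fun h0 => hQ ((gcd_eq_zero_iff _ _).1 h0).2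
    refine ⟨P', Q', ?_, hP', hQ'⟩
    obtain ⟨x, y, hxy⟩ := exists_gcd_eq_mul_add_mul P Q
    refine ⟨x, y, mul_left_cancel₀ hg ?_⟩
    calc gcd P Q * (x * P' + y * Q') = (gcd P Q * P') * x + (gcd P Q * Q') * y := by ring
      _ = gcd P Q * 1 := by rw [← hP', ← hQ', ← hxy, mul_one]
  set G := gcd P Q
  have hcomp0 : ∀ {R : k[X]}, R ≠ 0 → R.comp α ≠ 0 := fun {R} hR h0 => by
    rcases comp_eq_zero_iff.1 h0 with h1 | ⟨-, h1⟩
    · exact hR h1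
    · rw [h1, natDegree_C] at hα; exact lt_irrefl _ hα
  have hG : G ≠ 0 := by rintro h0; rw [h0, zero_mul] at hQ'; exact hQ hQ'
  have hQ0 : Q' ≠ 0 := by rintro h0; rw [h0, mul_zero] at hQ'; exact hQ hQ'
  rw [hP', hQ', mul_comp, mul_comp, mul_assoc] at h
  have h' := mul_left_cancel₀ (hcomp0 hG) h
  have hunit : IsUnit (Q'.comp α) := by
    obtain ⟨a, b, hab⟩ := hcop
    refine isUnit_of_dvd_one ⟨a.comp α * β + b.comp α, ?_⟩
    have := congrArg (fun q => q.comp α) hab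
    simp only [add_comp, mul_comp, one_comp] at this
    rw [← this, ← h']; ring
  have hdeg : Q'.natDegree = 0 := by
    have := natDegree_eq_zero_of_isUnit hunit
    rw [natDegree_comp] at this
    rcases Nat.mul_eq_zero.1 this with h1 | h1 <;> omega
  obtain ⟨q, hq⟩ := natDegree_eq_zero.1 hdeg
  have hq0 : q ≠ 0 := by rintro rfl; simp [← hq] at hQ0
  refine ⟨C q⁻¹ * P', ?_⟩
  rw [mul_comp, ← h', ← hq, C_comp, C_comp, ← mul_assoc, ← C_mul, inv_mul_cancel₀ hq0, C_1, one_mul]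

/-- Two polynomials without constant term, each a polynomial in the other, are proportional. -/
theorem exists_eq_smul_of_comp {α β D E : k[X]} (hα : 0 < α.natDegree) (hα0 : α.eval 0 = 0)
    (hβ0 : β.eval 0 = 0) (hD : β = D.comp α) (hE : α = E.comp β) : ∃ c : k, α = c • β := by
  have h1 := congrArg natDegree hD
  have h2 := congrArg natDegree hE
  rw [natDegree_comp] at h1 h2
  have hE1 : E.natDegree = 1 := by
    have : E.natDegree * D.natDegree = 1 := by
      rw [h1, ← mul_assoc] at h2
      exact Nat.eq_of_mul_eq_mul_right hα (by rw [← h2, one_mul])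
    exact Nat.eq_one_of_mul_eq_one_right this
  obtain ⟨a, -, b, hab⟩ := natDegree_eq_one.1 hE1
  have hb : b = 0 := by
    have := congrArg (eval 0) hE
    simpa [← hab, hα0, hβ0] using this.symm
  refine ⟨a, ?_⟩
  conv_lhs => rw [hE, ← hab]
  simp [hb, smul_eq_C_mul]

end Composition

/-! ### The affine chart and birational equivalences -/

section Chart

variable {k : Type*} [Field k]

theorem vec_one_ne_zero (u v : k) : (![u, v, 1] : Fin 3 → k) ≠ 0 := fun h => by
  simpa using congrFun h 2

/-- The point `(u : v : 1)` of the projective plane. -/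
def affPt (u v : k) : ℙ k (Fin 3 → k) :=
  Projectivization.mk k ![u, v, 1] (vec_one_ne_zero u v)

theorem affPt_injective {u v u' v' : k} (h : affPt u v = affPt u' v') : u = u' ∧ v = v' := by
  obtain ⟨c, hc⟩ := (Projectivization.mk_eq_mk_iff' _ _ _ _ _).1 h
  have h0 := congrFun hc 0
  have h1 := congrFun hc 1
  have h2 := congrFun hc 2
  simp at h0 h1 h2
  subst h2
  simp_all

theorem mk_eq_affPt {v : Fin 3 → k} (hv : v ≠ 0) (h2 : v 2 ≠ 0) :
    Projectivization.mk k v hv = affPt (v 0 / v 2) (v 1 / v 2) := by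
  refine (Projectivization.mk_eq_mk_iff' _ _ _ _ _).2 ⟨v 2, ?_⟩
  ext i
  fin_cases i <;> simp <;> field_simp

/-- The chart `z ≠ 0`. -/
abbrev chart (k : Type*) [Field k] : Set (ℙ k (Fin 3 → k)) :=
  nonvanishing (MvPolynomial.X 2 : MvPolynomial (Fin 3) k)

theorem isZariskiOpen_chart : IsZariskiOpen (chart k) :=
  isZariskiOpen_nonvanishing (MvPolynomial.isHomogeneous_X k 2)

theorem mk_mem_chart {v : Fin 3 → k} (hv : v ≠ 0) :
    Projectivization.mk k v hv ∈ chart k ↔ v 2 ≠ 0 := by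
  rw [mk_mem_nonvanishing (MvPolynomial.isHomogeneous_X k 2), MvPolynomial.eval_X]

theorem affPt_mem_chart (u v : k) : affPt u v ∈ chart k := by
  rw [affPt, mk_mem_chart]; simp

theorem exists_eq_affPt {P : ℙ k (Fin 3 → k)} (hP : P ∈ chart k) : ∃ u v, P = affPt u v := by
  induction P using Projectivization.ind with
  | h v hv => exact ⟨_, _, mk_eq_affPt hv ((mk_mem_chart hv).1 hP)⟩

theorem act_mk {n : ℕ} (A : ExpMat n k) (t : k) {v : Fin n → k} (hv : v ≠ 0) :
    A.act t (Projectivization.mk k v hv) =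
      Projectivization.mk k (A.at t *ᵥ v)
        (fun h => hv (A.at_injective t (by simpa using h))) := by
  simp [ExpMat.act, Projectivization.map_mk]

theorem act_affPt (A : ExpMat 3 k) {t u v u' v' : k} (h : A.at t *ᵥ ![u, v, 1] = ![u', v', 1]) :
    A.act t (affPt u v) = affPt u' v' := by
  simp only [affPt, act_mk, h]

/-- Conjugate exponential matrices are birationally equivalent, by a linear transformation. -/
theorem birEquiv_of_conj {n : ℕ} [NeZero n] {A B : ExpMat n k} {M N : Matrix (Fin n) (Fin n) k}
    (hMN : M * N = 1) (h : ∀ t, M * A.at t = B.at t * M) : BirEquiv A B := by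
  have hNM : N * M = 1 := mul_eq_one_comm.1 hMN
  have hinj : ∀ {M N : Matrix (Fin n) (Fin n) k}, N * M = 1 →
      Function.Injective M.mulVecLin := fun {M N} hNM =>
    Function.LeftInverse.injective (g := N.mulVecLin) fun v => by
      simp [Matrix.mulVec_mulVec, hNM]
  have hreg : ∀ {M N : Matrix (Fin n) (Fin n) k} (hNM : N * M = 1),
      IsRegularOn (Projectivization.map M.mulVecLin (hinj hNM)) Set.univ := by
    intro M N hNM P _
    refine ⟨Set.univ, isZariskiOpen_univ, trivial, 1,
      fun i => ∑ j, MvPolynomial.C (M i j) * MvPolynomial.X j, fun i => ?_, ?_⟩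
    · exact MvPolynomial.IsHomogeneous.sum _ _ _ fun j _ =>
        MvPolynomial.isHomogeneous_C_mul_X _ _
    · intro v hv _
      have hE : (fun i => MvPolynomial.eval v
          (∑ j, MvPolynomial.C (M i j) * MvPolynomial.X j)) = M.mulVecLin v := by
        ext i
        simp [Matrix.mulVec, dotProduct]
      simp only [hE]
      exact ⟨fun h0 => hv (hinj hNM (by simpa using h0)), rfl⟩
  have hinv : ∀ {M N : Matrix (Fin n) (Fin n) k} (hMN : M * N = 1) (hNM : N * M = 1)
      (P : ℙ k (Fin n → k)), Projectivization.map M.mulVecLin (hinj hNM)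
        (Projectivization.map N.mulVecLin (hinj hMN) P) = P := by
    intro M N hMN hNM P
    induction P using Projectivization.ind with
    | h v hv => simp [Projectivization.map_mk, Matrix.mulVec_mulVec, hMN]
  refine ⟨⟨Projectivization.map M.mulVecLin (hinj hNM), Projectivization.map N.mulVecLin (hinj hMN),
    Set.univ, Set.univ, fun _ _ => trivial, fun _ _ => trivial, fun P _ => hinv hNM hMN P,
    fun P _ => hinv hMN hNM P⟩, ⟨isZariskiOpen_univ, isZariskiOpen_univ,
    ⟨Projectivization.mk k 1 one_ne_zero, trivial⟩, hreg hNM, hreg hMN⟩, ?_⟩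
  intro t P _ _
  induction P using Projectivization.ind with
  | h v hv => simp [act_mk, Projectivization.map_mk, Matrix.mulVec_mulVec, h]

/-- The elementary transformation `(u, v) ↦ (u - d(v), v)` of the chart `z ≠ 0`; its values off
this chart are irrelevant. -/
noncomputable def shear (d : k[X]) (P : ℙ k (Fin 3 → k)) : ℙ k (Fin 3 → k) :=
  affPt (P.rep 0 / P.rep 2 - d.eval (P.rep 1 / P.rep 2)) (P.rep 1 / P.rep 2)

theorem shear_mk (d : k[X]) {v : Fin 3 → k} (hv : v ≠ 0) :
    shear d (Projectivization.mk k v hv) =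
      affPt (v 0 / v 2 - d.eval (v 1 / v 2)) (v 1 / v 2) := by
  obtain ⟨a, ha⟩ := Projectivization.exists_smul_eq_mk_rep k v hv
  have hdiv : ∀ i, (Projectivization.mk k v hv).rep i / (Projectivization.mk k v hv).rep 2 =
      v i / v 2 := fun i => by
    rw [← ha]
    exact mul_div_mul_left _ _ a.ne_zero
  rw [shear, hdiv, hdiv]

theorem shear_affPt (d : k[X]) (u v : k) : shear d (affPt u v) = affPt (u - d.eval v) v := by
  rw [affPt, shear_mk]; simp

theorem isRegularOn_shear (d : k[X]) : IsRegularOn (shear d) (chart k) := by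
  intro P _
  set N := d.natDegree
  -- `(x zᴺ - D(y, z) : y zᴺ : zᴺ⁺¹)` with `D` the homogenization of `d` in degree `N + 1`
  set D : MvPolynomial (Fin 3) k := ∑ i ∈ Finset.range (N + 1),
    MvPolynomial.C (d.coeff i) * (MvPolynomial.X 1 ^ i * MvPolynomial.X 2 ^ (N + 1 - i)) with hD
  have hX : ∀ (j : Fin 3) (m : ℕ),
      ((MvPolynomial.X j : MvPolynomial (Fin 3) k) ^ m).IsHomogeneous m :=
    fun j m => by simpa using (MvPolynomial.isHomogeneous_X k j).pow m
  refine ⟨Set.univ, isZariskiOpen_univ, trivial, N + 1,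
    ![MvPolynomial.X 0 * MvPolynomial.X 2 ^ N - D, MvPolynomial.X 1 * MvPolynomial.X 2 ^ N,
      MvPolynomial.X 2 ^ (N + 1)], ?_, ?_⟩
  · have hmul : ∀ j : Fin 3, (MvPolynomial.X j * MvPolynomial.X 2 ^ N :
        MvPolynomial (Fin 3) k).IsHomogeneous (N + 1) := fun j => by
      rw [add_comm]; exact (MvPolynomial.isHomogeneous_X k j).mul (hX 2 N)
    have hDh : D.IsHomogeneous (N + 1) := by
      refine MvPolynomial.IsHomogeneous.sum _ _ _ fun i hi => ?_
      have hi' : i ≤ N := by simpa [Nat.lt_succ_iff] using hi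
      have := (MvPolynomial.isHomogeneous_C (Fin 3) (d.coeff i)).mul
        ((hX 1 i).mul (hX 2 (N + 1 - i)))
      rwa [show 0 + (i + (N + 1 - i)) = N + 1 by omega] at this
    intro i
    fin_cases i
    · exact (hmul 0).sub hDh
    · exact hmul 1
    · exact hX 2 _
  · rintro v hv ⟨hm, -⟩
    have h2 := (mk_mem_chart hv).1 hm
    have hDv : MvPolynomial.eval v D = v 2 ^ (N + 1) * d.eval (v 1 / v 2) := by
      rw [hD, map_sum, eval_eq_sum_range, Finset.mul_sum]
      refine Finset.sum_congr rfl fun i hi => ?_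
      have hi' : i ≤ N := by simpa [Nat.lt_succ_iff] using hi
      have h3 : v 2 ^ (N + 1) = v 2 ^ (N + 1 - i) * v 2 ^ i := by
        rw [← pow_add]; congr 1; omega
      simp only [map_mul, map_pow, MvPolynomial.eval_C, MvPolynomial.eval_X, h3, div_pow]
      field_simp
    have hz : (fun i => MvPolynomial.eval v ((![MvPolynomial.X 0 * MvPolynomial.X 2 ^ N - D,
        MvPolynomial.X 1 * MvPolynomial.X 2 ^ N, MvPolynomial.X 2 ^ (N + 1)] :
          Fin 3 → MvPolynomial (Fin 3) k) i)) =
        ![v 0 * v 2 ^ N - v 2 ^ (N + 1) * d.eval (v 1 / v 2), v 1 * v 2 ^ N, v 2 ^ (N + 1)] := by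
      ext i
      fin_cases i <;> simp [hDv]
    simp only [hz]
    have hw : (![v 0 * v 2 ^ N - v 2 ^ (N + 1) * d.eval (v 1 / v 2), v 1 * v 2 ^ N,
        v 2 ^ (N + 1)] : Fin 3 → k) ≠ 0 := fun h => by
      have := congrFun h 2
      simp [h2] at this
    refine ⟨hw, ?_⟩
    rw [shear_mk, mk_eq_affPt hw (by simp [h2])]
    congr 1
    · simp only [Matrix.cons_val]; field_simp; ring
    · simp only [Matrix.cons_val]; field_simp; ring

/-- Exponential matrices that preserve the chart `z ≠ 0` are birationally equivalent if the shear
`(u, v) ↦ (u - d(v), v)` intertwines them. -/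
theorem birEquiv_of_shear (d : k[X]) {A B : ExpMat 3 k}
    (h : ∀ t u v, ∃ u' v', A.at t *ᵥ ![u, v, 1] = ![u', v', 1] ∧
      B.at t *ᵥ ![u - d.eval v, v, 1] = ![u' - d.eval v', v', 1]) : BirEquiv A B := by
  have hmaps : ∀ d : k[X], Set.MapsTo (shear d) (chart k) (chart k) := fun d P _ =>
    affPt_mem_chart _ _
  have hinv : ∀ d : k[X], ∀ P ∈ chart k, shear (-d) (shear d P) = P := fun d P hP => by
    obtain ⟨u, v, rfl⟩ := exists_eq_affPt hP
    simp [shear_affPt]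
  refine ⟨⟨shear d, shear (-d), chart k, chart k, hmaps d, hmaps (-d), hinv d, fun P hP => by
    simpa using hinv (-d) P hP⟩, ⟨isZariskiOpen_chart, isZariskiOpen_chart,
      ⟨affPt 0 0, affPt_mem_chart 0 0⟩, isRegularOn_shear d, isRegularOn_shear (-d)⟩, ?_⟩
  intro t P hP _
  obtain ⟨u, v, rfl⟩ := exists_eq_affPt hP
  obtain ⟨u', v', h1, h2⟩ := h t u v
  simp only [shear_affPt, act_affPt A h1, act_affPt B h2]

end Chart

/-! ### The span of the two polynomials is a birational invariant -/

section Invariant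

variable {k : Type*} [Field k]

/-- If a regular map carries an orbit `(u₀ + α(t) : v₀ : 1)` to an orbit `(u₁ + β(t) : v₁ : 1)`,
then `β` is a polynomial in `α`. -/
theorem exists_eq_comp_of_isRegularOn [Infinite k] {φ : ℙ k (Fin 3 → k) → ℙ k (Fin 3 → k)}
    {U : Set (ℙ k (Fin 3 → k))} (hφ : IsRegularOn φ U) {u₀ v₀ u₁ v₁ : k} {α β q : k[X]}
    (hα : 0 < α.natDegree) (hα0 : α.eval 0 = 0) (hq0 : q.eval 0 ≠ 0)
    (h : ∀ t, q.eval t ≠ 0 → affPt (u₀ + α.eval t) v₀ ∈ U ∧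
      φ (affPt (u₀ + α.eval t) v₀) = affPt (u₁ + β.eval t) v₁) :
    ∃ D : k[X], β = D.comp α := by
  obtain ⟨h0U, h0⟩ := h 0 hq0
  rw [hα0, add_zero] at h0U h0
  obtain ⟨V, hV, h0V, d, f, hf, hfV⟩ := hφ _ h0U
  obtain ⟨e, F, hF, h0F, hFV⟩ := hV _ h0V
  -- restriction of polynomials to the line `(u₀ + X : v₀ : 1)`
  let r : MvPolynomial (Fin 3) k → k[X] := MvPolynomial.aeval ![C u₀ + X, C v₀, 1]
  have hr : ∀ (G : MvPolynomial (Fin 3) k) (s : k),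
      (r G).eval s = MvPolynomial.eval ![u₀ + s, v₀, 1] G := by
    intro G s
    have : ((Polynomial.aeval s).comp (MvPolynomial.aeval ![C u₀ + X, C v₀, 1]) :
        MvPolynomial (Fin 3) k →ₐ[k] k) = MvPolynomial.aeval ![u₀ + s, v₀, 1] := by
      ext i
      fin_cases i <;> simp
    have := DFunLike.congr_fun this G
    simpa [Polynomial.coe_aeval_eq_eval, MvPolynomial.coe_aeval_eq_eval] using this
  have hval : ∀ s x, affPt (u₀ + s) v₀ ∈ U → affPt (u₀ + s) v₀ ∈ V →
      φ (affPt (u₀ + s) v₀) = affPt x v₁ →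
      (r (f 2)).eval s ≠ 0 ∧ (r (f 2)).eval s * x = (r (f 0)).eval s := by
    intro s x hU hV hx
    obtain ⟨hw, hφw⟩ := hfV _ (vec_one_ne_zero (u₀ + s) v₀) ⟨hU, hV⟩
    have hx' := hφw.symm.trans hx
    have hw2 := (mk_mem_chart hw).1 (hx' ▸ affPt_mem_chart x v₁)
    rw [mk_eq_affPt hw hw2] at hx'
    rw [hr, hr, ← (affPt_injective hx').1]
    exact ⟨hw2, mul_div_cancel₀ _ hw2⟩
  have hFr : (r F).comp α ≠ 0 := by
    intro hF0
    have := congrArg (eval 0) hF0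
    rw [eval_comp, hα0, hr, add_zero, eval_zero] at this
    exact (mk_mem_nonvanishing hF _ (vec_one_ne_zero u₀ v₀)).1 h0F this
  have hf2 : r (f 2) ≠ 0 := by
    have := (hval 0 _ (by rwa [add_zero]) (by rwa [add_zero]) (by rw [add_zero, h0])).1
    intro h2
    simp [h2] at this
  have hq : q ≠ 0 := by rintro rfl; simp at hq0
  have key : (r (f 2)).comp α * (C u₁ + β) = (r (f 0)).comp α := by
    have hz : q * (r F).comp α * ((r (f 2)).comp α * (C u₁ + β) - (r (f 0)).comp α) = 0 := by
      refine Polynomial.funext fun t => ?_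
      simp only [eval_mul, eval_sub, eval_add, eval_comp, eval_C, eval_zero]
      by_cases hqt : q.eval t = 0
      · simp [hqt]
      by_cases hFt : (r F).eval (α.eval t) = 0
      · simp [hFt]
      obtain ⟨hU, hx⟩ := h t hqt
      rw [hr] at hFt
      have := (hval _ _ hU (hFV ((mk_mem_nonvanishing hF _ (vec_one_ne_zero _ _)).2 hFt)) hx).2
      rw [this, sub_self, mul_zero]
    exact sub_eq_zero.1 ((mul_eq_zero.1 hz).resolve_left (mul_ne_zero hq hFr))
  refine exists_eq_comp (P := r (f 0) - C u₁ * r (f 2)) hα hf2 ?_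
  rw [sub_comp, mul_comp, C_comp, ← key]
  ring

variable {p : ℕ} [Fact p.Prime] [CharP k p]

theorem matA12_mulVec (a b : pPoly p k) (t u v : k) :
    (matA12 a b).at t *ᵥ ![u, v, 1] = ![u + ((v • a + b : pPoly p k) : k[X]).eval t, v, 1] := by
  ext i
  fin_cases i <;> simp [ExpMat.at, matA12, Matrix.mulVec, dotProduct, Fin.sum_univ_three]
  ring

/-- `t` acts on the line `v = v₀` by the translation by `v₀ α₁(t) + α₂(t)`. -/
theorem matA12_act (a b : pPoly p k) (t u v : k) :
    (matA12 a b).act t (affPt u v) =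
      affPt (u + ((v • a + b : pPoly p k) : k[X]).eval t) v :=
  act_affPt _ (matA12_mulVec a b t u v)

/-- A nonempty open subset contains a point `(u : v : 1)` for at least two values of `v`. -/
theorem exists_two_lines [Infinite k] {U : Set (ℙ k (Fin 3 → k))} (hU : IsZariskiOpen U)
    (hU' : U.Nonempty) : ∃ u v u' v', v ≠ v' ∧ affPt u v ∈ U ∧ affPt u' v' ∈ U := by
  obtain ⟨P, hP, hPc⟩ := hU.inter_nonempty isZariskiOpen_chart hU' ⟨_, affPt_mem_chart 0 0⟩
  obtain ⟨u, v, rfl⟩ := exists_eq_affPt hPc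
  obtain ⟨e, F, hF, hPF, hFU⟩ := hU _ hP
  let r : k[X] := MvPolynomial.aeval ![C u, C v + X, 1] F
  have hr : ∀ s : k, r.eval s = MvPolynomial.eval ![u, v + s, 1] F := by
    intro s
    have : ((Polynomial.aeval s).comp (MvPolynomial.aeval ![C u, C v + X, 1]) :
        MvPolynomial (Fin 3) k →ₐ[k] k) = MvPolynomial.aeval ![u, v + s, 1] := by
      ext i
      fin_cases i <;> simp
    have := DFunLike.congr_fun this F
    simpa [Polynomial.coe_aeval_eq_eval, MvPolynomial.coe_aeval_eq_eval] using this
  have hr0 : r ≠ 0 := by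
    intro h
    have := hr 0
    rw [h, eval_zero, add_zero] at this
    exact (mk_mem_nonvanishing hF _ (vec_one_ne_zero u v)).1 hPF this.symm
  obtain ⟨s, hs⟩ : ∃ s, (r * X).eval s ≠ 0 := by
    by_contra! h
    exact mul_ne_zero hr0 X_ne_zero (Polynomial.funext fun s => by simpa using h s)
  rw [eval_mul, eval_X, hr] at hs
  exact ⟨u, v, u, v + s, by simpa using (right_ne_zero_of_mul hs), hP,
    hFU ((mk_mem_nonvanishing hF _ (vec_one_ne_zero _ _)).2 (left_ne_zero_of_mul hs))⟩

/-- A birational equivalence carries the generic line `v = v₀`, on which the action is by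
translations through `α = v₀ α₁ + α₂`, to a line `v = v₁`; the translations there are through a
multiple of `α`, since the induced map of lines is birational.  So `α` lies in the span of
`β₁, β₂`, and two values of `v₀` give `α₁` and `α₂`. -/
theorem span_le_of_birEquiv [Infinite k] {a₁ a₂ b₁ b₂ : pPoly p k}
    (h : BirEquiv (matA12 a₁ a₂) (matA12 b₁ b₂)) :
    Submodule.span k {a₁, a₂} ≤ Submodule.span k {b₁, b₂} := by
  obtain ⟨σ, hσ, hc⟩ := h
  have hopen : IsZariskiOpen (σ.source ∩ σ ⁻¹' chart k) :=
    hσ.regular.isZariskiOpen_preimage hσ.isOpen_source isZariskiOpen_chart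
  have hne : (σ.source ∩ σ ⁻¹' chart k).Nonempty := by
    obtain ⟨Q, hQ, hQ'⟩ := hσ.isOpen_target.inter_nonempty isZariskiOpen_chart
      hσ.symm.nonempty ⟨_, affPt_mem_chart 0 0⟩
    exact ⟨σ.symm Q, σ.map_target hQ, by simpa [σ.right_inv hQ] using hQ'⟩
  have hline : ∀ u v, affPt u v ∈ σ.source ∩ σ ⁻¹' chart k →
      v • a₁ + a₂ ∈ Submodule.span k {b₁, b₂} := by
    rintro u₀ v₀ ⟨hs, hch⟩
    obtain ⟨u₁, v₁, h1⟩ := exists_eq_affPt (P := σ (affPt u₀ v₀)) hch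
    set α := v₀ • a₁ + a₂ with hαdef
    set β := v₁ • b₁ + b₂ with hβdef
    by_cases hα : α = 0
    · rw [hα]; exact zero_mem _
    have hα0 := eval_zero_of_mem_pPoly α.2
    have hβ0 := eval_zero_of_mem_pPoly β.2
    obtain ⟨e, F, hF, h0F, hFU⟩ := hσ.isOpen_source _ hs
    -- the orbit of the point stays in the source of `σ` where `q(t) ≠ 0`
    let q : k[X] := MvPolynomial.aeval ![C u₀ + (α : k[X]), C v₀, 1] F
    have hq : ∀ t : k, q.eval t = MvPolynomial.eval ![u₀ + (α : k[X]).eval t, v₀, 1] F := by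
      intro t
      have : ((Polynomial.aeval t).comp (MvPolynomial.aeval ![C u₀ + (α : k[X]), C v₀, 1]) :
          MvPolynomial (Fin 3) k →ₐ[k] k) =
          MvPolynomial.aeval ![u₀ + (α : k[X]).eval t, v₀, 1] := by
        ext i
        fin_cases i <;> simp [Polynomial.coe_aeval_eq_eval]
      have := DFunLike.congr_fun this F
      simpa [Polynomial.coe_aeval_eq_eval, MvPolynomial.coe_aeval_eq_eval] using this
    have hq0 : q.eval 0 ≠ 0 := by
      rw [hq, hα0, add_zero]
      exact (mk_mem_nonvanishing hF _ (vec_one_ne_zero _ _)).1 h0F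
    have hsrc : ∀ t, q.eval t ≠ 0 → affPt (u₀ + (α : k[X]).eval t) v₀ ∈ σ.source := by
      intro t ht
      rw [hq] at ht
      exact hFU ((mk_mem_nonvanishing hF _ (vec_one_ne_zero _ _)).2 ht)
    have hmap : ∀ t, q.eval t ≠ 0 → σ (affPt (u₀ + (α : k[X]).eval t) v₀) =
        affPt (u₁ + (β : k[X]).eval t) v₁ := by
      intro t ht
      have hact := matA12_act a₁ a₂ t u₀ v₀
      have := hc t _ hs (by rw [hact]; exact hsrc t ht)
      rwa [hact, h1, matA12_act] at this
    have hαd := natDegree_pos_of_ne_zero hα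
    obtain ⟨D, hD⟩ := exists_eq_comp_of_isRegularOn hσ.regular hαd hα0 hq0
      fun t ht => ⟨hsrc t ht, hmap t ht⟩
    have hinv : ∀ t, q.eval t ≠ 0 → affPt (u₁ + (β : k[X]).eval t) v₁ ∈ σ.target ∧
        σ.symm (affPt (u₁ + (β : k[X]).eval t) v₁) = affPt (u₀ + (α : k[X]).eval t) v₀ := by
      intro t ht
      rw [← hmap t ht]
      exact ⟨σ.map_source (hsrc t ht), σ.left_inv (hsrc t ht)⟩
    have hβ : β ≠ 0 := by
      -- if `β` vanished, `σ` would collapse the orbit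
      intro hβ
      have hz : q * α = 0 := by
        refine Polynomial.funext fun t => ?_
        rw [eval_mul, eval_zero]
        by_cases ht : q.eval t = 0
        · simp [ht]
        have e1 := (hinv t ht).2
        have e2 := (hinv 0 hq0).2
        simp only [hβ, ZeroMemClass.coe_zero, eval_zero] at e1 e2
        have := (affPt_injective (e1.symm.trans e2)).1
        rw [hα0] at this
        rw [add_left_cancel this, mul_zero]
      rcases mul_eq_zero.1 hz with h | h
      · simp [h] at hq0
      · exact hα (by simpa using h)
    obtain ⟨E, hE⟩ := exists_eq_comp_of_isRegularOn hσ.regular_symm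
      (natDegree_pos_of_ne_zero hβ) hβ0 hq0 hinv
    obtain ⟨c, hc⟩ := exists_eq_smul_of_comp hαd hα0 hβ0 hD hE
    have : α = c • β := Subtype.ext hc
    rw [this]
    exact Submodule.smul_mem _ _ (Submodule.mem_span_pair.2 ⟨v₁, 1, by rw [hβdef, one_smul]⟩)
  obtain ⟨u, v, u', v', hvv, hm, hm'⟩ := exists_two_lines hopen hne
  have h1 := hline u v hm
  have h2 := hline u' v' hm'
  have ha₁ : a₁ ∈ Submodule.span k {b₁, b₂} := by
    have h3 := Submodule.smul_mem _ (v - v')⁻¹ (sub_mem h1 h2)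
    have h4 : v • a₁ + a₂ - (v' • a₁ + a₂) = (v - v') • a₁ := by module
    rwa [h4, smul_smul, inv_mul_cancel₀ (sub_ne_zero.2 hvv), one_smul] at h3
  have ha₂ : a₂ ∈ Submodule.span k {b₁, b₂} := by
    simpa using sub_mem h1 (Submodule.smul_mem _ v ha₁)
  rw [Submodule.span_le]
  rintro x (rfl | rfl)
  exacts [ha₁, ha₂]

theorem span_eq_of_birEquiv [Infinite k] {a₁ a₂ b₁ b₂ : pPoly p k}
    (h : BirEquiv (matA12 a₁ a₂) (matA12 b₁ b₂)) :
    Submodule.span k {a₁, a₂} = Submodule.span k {b₁, b₂} :=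
  le_antisymm (span_le_of_birEquiv h) (span_le_of_birEquiv h.symm)

end Invariant

/-! ### Triangularization -/

section Triangular

variable {k : Type*} [Field k] {n : ℕ}

theorem isExponential_of_eval [Infinite k] {A : Matrix (Fin n) (Fin n) k[X]}
    (h : ∀ s t : k, A.map (eval s) * A.map (eval t) = A.map (eval (s + t)))
    (h0 : A.map (eval 0) = 1) : IsExponential A := by
  refine ⟨?_, h0⟩
  have key : ∀ (w : Fin 2 → k) (q : MvPolynomial (Fin 2) k) (P : k[X]),
      MvPolynomial.eval w (aeval q P) = eval (MvPolynomial.eval w q) P := by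
    intro w q P
    rw [Polynomial.aeval_def, Polynomial.hom_eval₂]
    have : (MvPolynomial.eval w).comp (algebraMap k (MvPolynomial (Fin 2) k)) = RingHom.id k := by
      ext x; simp [MvPolynomial.algebraMap_eq]
    rw [this]; rfl
  ext1 i j
  refine MvPolynomial.funext fun w => ?_
  simpa [Matrix.mul_apply, map_sum, key] using congrFun (congrFun (h (w 0) (w 1)) i) j

theorem exists_conj [Infinite k] (A : ExpMat n k) {M N : Matrix (Fin n) (Fin n) k}
    (hMN : M * N = 1) : ∃ B : ExpMat n k, ∀ t, B.at t = M * A.at t * N := by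
  have hNM : N * M = 1 := mul_eq_one_comm.1 hMN
  have hmap : ∀ t : k, (M.map C * A.1 * N.map C).map (eval t) = M * A.at t * N := fun t => by
    ext i j
    simp [Matrix.mul_apply, ExpMat.at, eval_finsetSum]
  refine ⟨⟨M.map C * A.1 * N.map C, isExponential_of_eval (fun s t => ?_) ?_⟩, hmap⟩
  · rw [hmap, hmap, hmap, ← A.at_add]
    calc M * A.at s * N * (M * A.at t * N) = M * A.at s * (N * M) * A.at t * N := by
          simp only [Matrix.mul_assoc]
      _ = M * (A.at s * A.at t) * N := by rw [hNM, Matrix.mul_one]; simp only [Matrix.mul_assoc]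
  · rw [hmap, A.at_zero, Matrix.mul_one, hMN]

/-- The matrix `N` of coefficients of top degree of a nonconstant exponential matrix `A(T)` is
fixed by `A(t)` on both sides and has square zero, as one sees on comparing coefficients in
`A(t) A(T) = A(t + T) = A(T) A(t)`. -/
theorem exists_fixed_sq_zero [Infinite k] (A : ExpMat n k) :
    (∀ t, A.at t = 1) ∨ ∃ N : Matrix (Fin n) (Fin n) k, N ≠ 0 ∧ N * N = 0 ∧
      ∀ t, A.at t * N = N ∧ N * A.at t = N := by
  set d := Finset.univ.sup fun x : Fin n × Fin n => (A.1 x.1 x.2).natDegree with hd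
  have hle : ∀ i j, (A.1 i j).natDegree ≤ d := fun i j =>
    Finset.le_sup (f := fun x : Fin n × Fin n => (A.1 x.1 x.2).natDegree)
      (Finset.mem_univ (i, j))
  rcases Nat.eq_zero_or_pos d with hd0 | hd0
  · left
    intro t
    rw [← A.at_zero]
    ext i j
    obtain ⟨a, ha⟩ := natDegree_eq_zero.1 (Nat.le_zero.1 (hd0 ▸ hle i j))
    simp [ExpMat.at, ← ha]
  right
  let N : Matrix (Fin n) (Fin n) k := Matrix.of fun i j => (A.1 i j).coeff d
  have htaylor : ∀ (t : k) (i j : Fin n), (taylor t (A.1 i j)).coeff d = N i j := by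
    intro t i j
    rcases (hle i j).lt_or_eq with h | h
    · rw [coeff_eq_zero_of_natDegree_lt (by rwa [natDegree_taylor])]
      exact (coeff_eq_zero_of_natDegree_lt h).symm
    · change _ = (A.1 i j).coeff d
      rw [← h, coeff_taylor_natDegree, leadingCoeff]
  have hleft : ∀ t, A.at t * N = N := by
    intro t
    ext i j
    have h : ∑ l, C (A.at t i l) * A.1 l j = taylor t (A.1 i j) := by
      refine Polynomial.funext fun s => ?_
      have := congrFun (congrFun (A.at_add t s) i) j
      rw [taylor_eval, add_comm s t]
      simpa [eval_finsetSum, Matrix.mul_apply, ExpMat.at] using this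
    have h' := congrArg (fun q => coeff q d) h
    simpa [htaylor, Matrix.mul_apply, N] using h'
  have hright : ∀ t, N * A.at t = N := by
    intro t
    ext i j
    have h : ∑ l, A.1 i l * C (A.at t l j) = taylor t (A.1 i j) := by
      refine Polynomial.funext fun s => ?_
      have := congrFun (congrFun (A.at_add s t) i) j
      rw [taylor_eval]
      simpa [eval_finsetSum, Matrix.mul_apply, ExpMat.at] using this
    have h' := congrArg (fun q => coeff q d) h
    simpa [htaylor, Matrix.mul_apply, N] using h'
  refine ⟨N, ?_, ?_, fun t => ⟨hleft t, hright t⟩⟩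
  · intro hN
    have hne : (Finset.univ : Finset (Fin n × Fin n)).Nonempty := by
      by_contra hne
      rw [Finset.not_nonempty_iff_eq_empty.1 hne] at hd
      simp at hd
      omega
    obtain ⟨⟨i, j⟩, -, hij⟩ := Finset.exists_mem_eq_sup _ hne
      fun x : Fin n × Fin n => (A.1 x.1 x.2).natDegree
    have h1 : (A.1 i j).natDegree = d := hij.symm
    have h2 : (A.1 i j).coeff d = 0 := congrFun (congrFun hN i) j
    rw [← h1, coeff_natDegree, leadingCoeff_eq_zero] at h2
    rw [h2, natDegree_zero] at h1
    omega
  · ext i j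
    have h : ∑ l, A.1 i l * C (N l j) = C (N i j) := by
      refine Polynomial.funext fun s => ?_
      have := congrFun (congrFun (hleft s) i) j
      simpa [eval_finsetSum, Matrix.mul_apply, ExpMat.at] using this
    have h' := congrArg (fun q => coeff q d) h
    simpa [Matrix.mul_apply, N, coeff_C, hd0.ne'] using h'

/-- A vector `v ≠ 0` and a row vector `w ≠ 0` with `w v = 0` are the first basis vector and the
last coordinate form in suitable coordinates. -/
theorem exists_coordinates {v w : Fin 3 → k} (hv : v ≠ 0) (hw : w ≠ 0) (h : w ⬝ᵥ v = 0) :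
    ∃ M N : Matrix (Fin 3) (Fin 3) k, M * N = 1 ∧ M *ᵥ v = ![1, 0, 0] ∧ M 2 = w := by
  have hdual : ∀ {x : Fin 3 → k}, x ≠ 0 → ∃ r : Fin 3 → k, r ⬝ᵥ x = 1 := by
    intro x hx
    obtain ⟨i, hi⟩ := Function.ne_iff.1 hx
    exact ⟨Pi.single i (x i)⁻¹, by rw [single_dotProduct]; exact inv_mul_cancel₀ hi⟩
  obtain ⟨r, hr⟩ := hdual hv
  obtain ⟨a, ha⟩ := hdual hw
  -- the determinant is `(r v) (a w) - (r a) (w v) = 1`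
  let M : Matrix (Fin 3) (Fin 3) k := ![r, crossProduct a v, w]
  have hM : M.det = 1 := by
    simp only [dotProduct, Fin.sum_univ_three] at h hr ha
    rw [Matrix.det_fin_three]
    simp only [M, cross_apply, Matrix.cons_val]
    linear_combination (r 0 * v 0 + r 1 * v 1 + r 2 * v 2) * ha + hr -
      (r 0 * a 0 + r 1 * a 1 + r 2 * a 2) * h
  refine ⟨M, M⁻¹, Matrix.mul_nonsing_inv _ (by simp [hM]), ?_, rfl⟩
  ext i
  fin_cases i
  · exact hr
  · change crossProduct a v ⬝ᵥ v = 0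
    simp only [cross_apply, dotProduct, Fin.sum_univ_three, Matrix.cons_val]
    ring
  · exact h

theorem matrix_eq_of_eval [Infinite k] {A B : Matrix (Fin n) (Fin n) k[X]}
    (h : ∀ t, A.map (eval t) = B.map (eval t)) : A = B := by
  ext1 i j
  exact Polynomial.funext fun t => congrFun (congrFun (h t) i) j

/-- Exponential matrices of size three are triangularizable. -/
theorem exists_unitriangular [Infinite k] (A : ExpMat 3 k) :
    ∃ (B : ExpMat 3 k) (a b c : k[X]), BirEquiv A B ∧ B.1 = !![1, a, c; 0, 1, b; 0, 0, 1] := by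
  rcases exists_fixed_sq_zero A with h | ⟨N, hN, hNN, hfix⟩
  · refine ⟨A, 0, 0, 0, BirEquiv.refl A, matrix_eq_of_eval fun t => (h t).trans ?_⟩
    ext i j
    fin_cases i <;> fin_cases j <;> simp
  obtain ⟨i, j, hij⟩ : ∃ i j, N i j ≠ 0 := by
    by_contra! h0
    exact hN (by ext i j; exact h0 i j)
  set v : Fin 3 → k := fun l => N l j with hv
  set w : Fin 3 → k := fun l => N i l with hw
  have hAv : ∀ t, A.at t *ᵥ v = v := fun t => by
    ext l; exact congrFun (congrFun (hfix t).1 l) j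
  have hwA : ∀ t, w ᵥ* A.at t = w := fun t => by
    ext l; exact congrFun (congrFun (hfix t).2 i) l
  obtain ⟨M, L, hML, hMv, hMw⟩ := exists_coordinates (v := v) (w := w)
    (fun h0 => hij (congrFun h0 i)) (fun h0 => hij (congrFun h0 j))
    (congrFun (congrFun hNN i) j)
  have hLM : L * M = 1 := mul_eq_one_comm.1 hML
  obtain ⟨B, hB⟩ := exists_conj A hML
  have hBM : ∀ t, M * A.at t = B.at t * M := fun t => by
    rw [hB, Matrix.mul_assoc _ L, hLM, Matrix.mul_one]
  have hcol : ∀ t, B.at t *ᵥ ![1, 0, 0] = ![1, 0, 0] := fun t => by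
    rw [← hMv, Matrix.mulVec_mulVec, ← hBM, ← Matrix.mulVec_mulVec, hAv]
  have hrow : ∀ t, B.at t 2 = ![0, 0, 1] := fun t => by
    have h1 : (M * A.at t) 2 = w := by
      rw [← hwA t, ← hMw]; rfl
    have h2 : B.at t 2 = w ᵥ* L := by
      rw [← h1, hB]; rfl
    rw [h2, ← hMw]
    have h3 : (M * L) 2 = M 2 ᵥ* L := rfl
    rw [← h3, hML]
    ext l
    fin_cases l <;> rfl
  have hcol' : ∀ t l, (B.1 l 0).eval t = (![1, 0, 0] : Fin 3 → k) l := fun t l => by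
    have := congrFun (hcol t) l
    simpa [Matrix.mulVec, dotProduct, Fin.sum_univ_three, ExpMat.at] using this
  have hrow' : ∀ t l, (B.1 2 l).eval t = (![0, 0, 1] : Fin 3 → k) l := fun t l =>
    congrFun (hrow t) l
  -- the middle entry is multiplicative, so a unit
  have hmid : B.1 1 1 = 1 := by
    have hmul : ∀ s t, (B.1 1 1).eval s * (B.1 1 1).eval t = (B.1 1 1).eval (s + t) := by
      intro s t
      have := congrFun (congrFun (B.at_add s t) 1) 1
      simpa [Matrix.mul_apply, Fin.sum_univ_three, ExpMat.at, hcol', hrow'] using this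
    have h0 : (B.1 1 1).eval 0 = 1 := by
      have := congrFun (congrFun B.at_zero 1) 1
      simpa [ExpMat.at] using this
    have hu : IsUnit (B.1 1 1) := by
      refine IsUnit.of_mul_eq_one ((B.1 1 1).comp (-X)) (Polynomial.funext fun t => ?_)
      simp [hmul, h0]
    obtain ⟨m, hm⟩ := natDegree_eq_zero.1 (natDegree_eq_zero_of_isUnit hu)
    rw [← hm, eval_C] at h0
    rw [← hm, h0, C_1]
  refine ⟨B, B.1 0 1, B.1 1 2, B.1 0 2, birEquiv_of_conj hML hBM, ?_⟩
  ext1 i j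
  refine Polynomial.funext fun t => ?_
  fin_cases i <;> fin_cases j <;> simp [hcol', hrow', hmid]

end Triangular

/-! ### Reduction to the standard forms -/

section Reduction

variable {p : ℕ} {k : Type*} [Field k] [Fact p.Prime] [CharP k p]

/-- The exponential matrix with rows `(1, 0, c)`, `(0, 1, b)`, `(0, 0, 1)`: the translations of
the plane by `(c(t), b(t))`. -/
noncomputable def translation (c b : pPoly p k) : ExpMat 3 k :=
  ⟨!![1, 0, (c : k[X]); 0, 1, (b : k[X]); 0, 0, 1], by
    constructor
    · ext1 i j
      fin_cases i <;> fin_cases j <;>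
        simp [Matrix.mul_apply, Fin.sum_univ_three, aeval_add_of_mem_pPoly b.2,
          aeval_add_of_mem_pPoly c.2, add_comm]
    · ext1 i j
      fin_cases i <;> fin_cases j <;>
        simp [eval_zero_of_mem_pPoly b.2, eval_zero_of_mem_pPoly c.2]⟩

theorem translation_mulVec (c b : pPoly p k) (t u v : k) :
    (translation c b).at t *ᵥ ![u, v, 1] =
      ![u + (c : k[X]).eval t, v + (b : k[X]).eval t, 1] := by
  ext i
  fin_cases i <;>
    simp [ExpMat.at, translation, Matrix.mulVec, dotProduct, Fin.sum_univ_three]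

theorem translation_zero_right (c : pPoly p k) : translation c 0 = matA12 0 c :=
  Subtype.ext (by simp [translation, matA12])

theorem matA11_eq_matA12 (a : pPoly p k) : matA11 a = matA12 0 a :=
  Subtype.ext (by simp [matA11, matA12])

theorem id_eq_matA12 : (ExpMat.id : ExpMat 3 k) = matA12 (0 : pPoly p k) 0 :=
  Subtype.ext (by ext1 i j; fin_cases i <;> fin_cases j <;> simp [ExpMat.id, matA12])

theorem translation_swap (c b : pPoly p k) : BirEquiv (translation c b) (translation b c) := by
  refine birEquiv_of_conj (M := !![0, 1, 0; 1, 0, 0; 0, 0, 1])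
    (N := !![0, 1, 0; 1, 0, 0; 0, 0, 1]) ?_ fun t => ?_
  · ext i j
    fin_cases i <;> fin_cases j <;> simp [Matrix.mul_apply, Fin.sum_univ_three]
  · ext i j
    fin_cases i <;> fin_cases j <;>
      simp [Matrix.mul_apply, Fin.sum_univ_three, ExpMat.at, translation]

variable [IsAlgClosed k]

/-- One step of the Euclidean algorithm: the top term of `c` is removed by a multiple of a power
of `b`. -/
theorem exists_smaller_translation {c b : pPoly p k} (hb : b ≠ 0)
    (hcb : (b : k[X]).natDegree ≤ (c : k[X]).natDegree) : ∃ c' : pPoly p k,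
      BirEquiv (translation c b) (translation c' b) ∧
        (c' : k[X]).natDegree < (c : k[X]).natDegree := by
  have hp : p.Prime := Fact.out
  have hc : c ≠ 0 := by
    rintro rfl
    have := natDegree_pos_of_ne_zero hb
    simp at hcb
    omega
  have hb' : (b : k[X]) ≠ 0 := by simpa using hb
  have hc' : (c : k[X]) ≠ 0 := by simpa using hc
  obtain ⟨m, hm⟩ := exists_natDegree_eq_pow c.2 hc'
  obtain ⟨l, hl⟩ := exists_natDegree_eq_pow b.2 hb'
  have hlm : l ≤ m := by
    rw [hm, hl] at hcb
    exact (Nat.pow_le_pow_iff_right hp.one_lt).1 hcb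
  set e := p ^ (m - l) with he
  set x := (c : k[X]).leadingCoeff / (b : k[X]).leadingCoeff ^ e with hx
  have hlb : (b : k[X]).leadingCoeff ^ e ≠ 0 := pow_ne_zero _ (leadingCoeff_ne_zero.2 hb')
  have hlc : (c : k[X]).leadingCoeff ≠ 0 := leadingCoeff_ne_zero.2 hc'
  have hx0 : x ≠ 0 := div_ne_zero hlc hlb
  have hmem : (c : k[X]) - C x * (b : k[X]) ^ e ∈ pPoly p k := by
    rw [mem_pPoly_iff]
    intro s t
    simp only [eval_sub, eval_mul, eval_C, eval_pow, eval_add_of_mem_pPoly c.2,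
      eval_add_of_mem_pPoly b.2, he, add_pow_char_pow]
    ring
  refine ⟨⟨_, hmem⟩, birEquiv_of_shear (C x * X ^ e) fun t u v =>
    ⟨_, _, translation_mulVec c b t u v, ?_⟩, ?_⟩
  · rw [translation_mulVec]
    congr 1
    simp only [eval_sub, eval_mul, eval_C, eval_pow, eval_X, he, add_pow_char_pow]
    ring
  · have hdeg : (C x * (b : k[X]) ^ e).natDegree = (c : k[X]).natDegree := by
      rw [natDegree_C_mul hx0, natDegree_pow, hl, hm, he, ← pow_add]
      congr 1
      omega
    have hlead : (C x * (b : k[X]) ^ e).leadingCoeff = (c : k[X]).leadingCoeff := by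
      rw [leadingCoeff_mul, leadingCoeff_C, leadingCoeff_pow, hx, div_mul_cancel₀ _ hlb]
    change ((c : k[X]) - C x * (b : k[X]) ^ e).natDegree < _
    by_cases h0 : (c : k[X]) - C x * (b : k[X]) ^ e = 0
    · rw [h0, natDegree_zero]
      exact natDegree_pos_of_ne_zero hc
    · refine natDegree_lt_natDegree h0 (degree_sub_lt_left ?_ hc' hlead.symm)
      rw [degree_eq_natDegree hc', degree_eq_natDegree (by
        intro h; rw [h] at hlead; exact hlc (by simpa using hlead.symm)), hdeg]

/-- The Euclidean algorithm for `p`-polynomials under composition makes one component of a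
translation zero. -/
theorem translation_birEquiv (c b : pPoly p k) :
    ∃ a : pPoly p k, BirEquiv (translation c b) (matA12 0 a) := by
  have : Infinite k := IsAlgClosed.instInfinite
  induction hd : (c : k[X]).natDegree + (b : k[X]).natDegree using Nat.strong_induction_on
    generalizing c b with
  | _ d ih =>
    subst hd
    by_cases hb : b = 0
    · exact ⟨c, by rw [hb, translation_zero_right]; exact BirEquiv.refl _⟩
    by_cases hc : c = 0
    · exact ⟨b, (translation_swap c b).trans
        (by rw [hc, translation_zero_right]; exact BirEquiv.refl _)⟩
    rcases le_total (b : k[X]).natDegree (c : k[X]).natDegree with h | h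
    · obtain ⟨c', h1, h2⟩ := exists_smaller_translation hb h
      obtain ⟨a, ha⟩ := ih _ (by omega) c' b rfl
      exact ⟨a, h1.trans ha⟩
    · obtain ⟨b', h1, h2⟩ := exists_smaller_translation hc h
      obtain ⟨a, ha⟩ := ih _ (by omega) b' c rfl
      exact ⟨a, ((translation_swap c b).trans h1).trans ha⟩

/-- Every exponential matrix of size three is birationally equivalent to one with rows
`(1, α₁, α₂)`, `(0, 1, 0)`, `(0, 0, 1)`. -/
theorem exists_birEquiv_matA12 (A : ExpMat 3 k) :
    ∃ a₁ a₂ : pPoly p k, BirEquiv A (matA12 a₁ a₂) := by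
  have : Infinite k := IsAlgClosed.instInfinite
  obtain ⟨B, a, b, c, hAB, hB⟩ := exists_unitriangular A
  have hadd : ∀ s t, B.at s * B.at t = B.at (s + t) := B.at_add
  simp only [ExpMat.at, hB] at hadd
  have ha : ∀ s t, a.eval (s + t) = a.eval s + a.eval t := fun s t => by
    have := congrFun (congrFun (hadd s t) 0) 1
    simpa [Matrix.mul_apply, Fin.sum_univ_three, add_comm] using this.symm
  have hb : ∀ s t, b.eval (s + t) = b.eval s + b.eval t := fun s t => by
    have := congrFun (congrFun (hadd s t) 1) 2
    simpa [Matrix.mul_apply, Fin.sum_univ_three, add_comm] using this.symm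
  have hc : ∀ s t, c.eval (s + t) = c.eval s + c.eval t + a.eval s * b.eval t := fun s t => by
    have := congrFun (congrFun (hadd s t) 0) 2
    simp [Matrix.mul_apply, Fin.sum_univ_three] at this
    linear_combination -this
  by_cases hb0 : b = 0
  · have hc' : ∀ s t, c.eval (s + t) = c.eval s + c.eval t := by simpa [hb0] using hc
    refine ⟨⟨a, mem_pPoly_of_eval_add ha⟩, ⟨c, mem_pPoly_of_eval_add hc'⟩, ?_⟩
    convert hAB
    exact Subtype.ext (by rw [hB, hb0]; rfl)
  obtain ⟨t₀, ht₀⟩ : ∃ t, b.eval t ≠ 0 := by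
    by_contra! h
    exact hb0 (Polynomial.funext fun t => by simpa using h t)
  -- commutativity makes `a` a multiple of `b`
  set l := a.eval t₀ / b.eval t₀ with hl
  have hal : ∀ s, a.eval s = l * b.eval s := fun s => by
    have h1 := hc s t₀
    rw [add_comm s t₀, hc t₀ s] at h1
    rw [hl, div_mul_eq_mul_div, eq_div_iff ht₀]
    linear_combination -h1
  -- in characteristic two, `0 = c(2 t) = a(t) b(t)` leaves only `l = 0`
  obtain ⟨μ, hμ⟩ : ∃ μ, l = 2 * μ := by
    by_cases h2 : (2 : k) = 0
    · refine ⟨0, ?_⟩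
      have hc0 := hc 0 0
      have h1 := hc t₀ t₀
      have hb00 := hb 0 0
      simp only [add_zero, left_eq_add] at hb00
      rw [← two_mul t₀, h2, zero_mul, hal t₀] at h1
      rw [add_zero, hb00, mul_zero] at hc0
      have h3 : l * b.eval t₀ * b.eval t₀ = 0 := by
        linear_combination -h1 - c.eval t₀ * h2 - hc0
      simpa [ht₀] using h3
    · exact ⟨l / 2, by field_simp⟩
  have hmem : c - C μ * b ^ 2 ∈ pPoly p k := by
    refine mem_pPoly_of_eval_add fun s t => ?_
    simp only [eval_sub, eval_mul, eval_C, eval_pow, hb, hc, hal, hμ]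
    ring
  have hshear : BirEquiv B (translation (⟨_, hmem⟩ : pPoly p k)
      ⟨b, mem_pPoly_of_eval_add hb⟩) := by
    refine birEquiv_of_shear (C μ * X ^ 2) fun t u v =>
      ⟨u + a.eval t * v + c.eval t, v + b.eval t, ?_, ?_⟩
    · ext i
      fin_cases i <;> simp [ExpMat.at, hB, Matrix.mulVec, dotProduct, Fin.sum_univ_three]
    · rw [translation_mulVec]
      congr 1
      simp only [eval_sub, eval_mul, eval_C, eval_pow, eval_X, hal, hμ]
      ring
  obtain ⟨a', ha'⟩ := translation_birEquiv (⟨_, hmem⟩ : pPoly p k) ⟨b, mem_pPoly_of_eval_add hb⟩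
  exact ⟨0, a', (hAB.trans hshear).trans ha'⟩

end Reduction

/-! ### The classification -/

section Classification

variable {p : ℕ} {k : Type*} [Field k]

theorem glEquiv_of_span_eq {m : ℕ} {a b : IndepTuple p k m}
    (h : Submodule.span k (Set.range a.1) = Submodule.span k (Set.range b.1)) : GLEquiv a b := by
  have hexists : ∀ {a b : IndepTuple p k m},
      Submodule.span k (Set.range a.1) = Submodule.span k (Set.range b.1) →
      ∃ Q : Matrix (Fin m) (Fin m) k, ∀ j, a.1 j = ∑ i, Q i j • b.1 i := by
    intro a b h
    have hmem : ∀ j, ∃ c : Fin m → k, ∑ i, c i • b.1 i = a.1 j := fun j =>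
      (Submodule.mem_span_range_iff_exists_fun k).1 (h ▸ Submodule.subset_span ⟨j, rfl⟩)
    choose c hc using hmem
    exact ⟨Matrix.of fun i j => c j i, fun j => (hc j).symm⟩
  have hmul : ∀ {a b : IndepTuple p k m} {Q R : Matrix (Fin m) (Fin m) k},
      (∀ j, a.1 j = ∑ i, Q i j • b.1 i) → (∀ j, b.1 j = ∑ i, R i j • a.1 i) → R * Q = 1 := by
    intro a b Q R hQ hR
    ext l j
    have h1 : ∑ i, (R * Q) i j • a.1 i = ∑ i, (1 : Matrix (Fin m) (Fin m) k) i j • a.1 i := by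
      trans a.1 j
      · rw [hQ j]
        simp only [hR, Matrix.mul_apply, Finset.smul_sum, Finset.sum_smul, smul_smul]
        rw [Finset.sum_comm]
        simp only [mul_comm]
      · simp [Matrix.one_apply]
    exact Fintype.linearIndependent_iffₛ.1 a.2 _ _ h1 l
  obtain ⟨Q, hQ⟩ := hexists h
  obtain ⟨R, hR⟩ := hexists h.symm
  exact ⟨⟨Q, R, hmul hR hQ, hmul hQ hR⟩, hQ⟩

theorem range_fin_two {α : Type*} (f : Fin 2 → α) : Set.range f = {f 0, f 1} := by
  ext x; simp [eq_comm]

theorem range_fin_one {α : Type*} (f : Fin 1 → α) : Set.range f = {f 0} := by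
  ext x; simp [eq_comm]

theorem span_zero_pair (a : IndepTuple p k 1) :
    Submodule.span k {0, a.1 0} = Submodule.span k (Set.range a.1) := by
  rw [range_fin_one, Submodule.span_insert_zero]

theorem span_pair (a : IndepTuple p k 2) :
    Submodule.span k {a.1 0, a.1 1} = Submodule.span k (Set.range a.1) := by
  rw [range_fin_two]

theorem finrank_span {m : ℕ} (a : IndepTuple p k m) :
    Module.finrank k (Submodule.span k (Set.range a.1)) = m := by
  rw [finrank_span_eq_card a.2, Fintype.card_fin]

variable [Fact p.Prime] [CharP k p]

theorem matA11_birEquiv {a b : IndepTuple p k 1} (h : GLEquiv a b) :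
    BirEquiv (matA11 (a.1 0)) (matA11 (b.1 0)) := by
  obtain ⟨Q, hQ⟩ := h
  have h0 : ((a.1 0 : pPoly p k) : k[X]) = C (Q.1 0 0) * (b.1 0 : k[X]) := by
    rw [hQ 0]; simp [smul_eq_C_mul]
  have hQQ : Q.1 0 0 * (Q⁻¹).1 0 0 = 1 := by
    have := congrFun (congrFun (Units.mul_inv Q) 0) 0
    simpa [Matrix.mul_apply] using this
  refine birEquiv_of_conj (M := !![1, 0, 0; 0, 1, 0; 0, 0, Q.1 0 0])
    (N := !![1, 0, 0; 0, 1, 0; 0, 0, (Q⁻¹).1 0 0]) ?_ fun t => ?_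
  · ext i j
    fin_cases i <;> fin_cases j <;> simp [Matrix.mul_apply, Fin.sum_univ_three]
    simpa using hQQ
  · ext i j
    fin_cases i <;> fin_cases j <;>
      simp [Matrix.mul_apply, Fin.sum_univ_three, ExpMat.at, matA11, h0]
    ring

theorem matA12_birEquiv {a b : IndepTuple p k 2} (h : GLEquiv a b) :
    BirEquiv (matA12 (a.1 0) (a.1 1)) (matA12 (b.1 0) (b.1 1)) := by
  obtain ⟨Q, hQ⟩ := h
  have h0 : ∀ j, ((a.1 j : pPoly p k) : k[X]) =
      C (Q.1 0 j) * (b.1 0 : k[X]) + C (Q.1 1 j) * (b.1 1 : k[X]) := fun j => by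
    rw [hQ j]; simp [smul_eq_C_mul]
  have hQQ : ∀ i j, Q.1 i 0 * (Q⁻¹).1 0 j + Q.1 i 1 * (Q⁻¹).1 1 j =
      (1 : Matrix (Fin 2) (Fin 2) k) i j := fun i j => by
    have := congrFun (congrFun (Units.mul_inv Q) i) j
    simpa only [Matrix.mul_apply, Fin.sum_univ_two] using this
  refine birEquiv_of_conj (M := !![1, 0, 0; 0, Q.1 0 0, Q.1 0 1; 0, Q.1 1 0, Q.1 1 1])
    (N := !![1, 0, 0; 0, (Q⁻¹).1 0 0, (Q⁻¹).1 0 1; 0, (Q⁻¹).1 1 0, (Q⁻¹).1 1 1]) ?_ fun t => ?_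
  · ext i j
    fin_cases i <;> fin_cases j <;>
      simp [Matrix.mul_apply, Fin.sum_univ_three, -Matrix.coe_units_inv, hQQ]
  · ext i j
    fin_cases i <;> fin_cases j <;>
      simp [Matrix.mul_apply, Fin.sum_univ_three, ExpMat.at, matA12, h0] <;> ring

/-- If the two polynomials are proportional, one of them can be made zero. -/
theorem matA12_smul_birEquiv (a : pPoly p k) (c : k) :
    BirEquiv (matA12 a (c • a)) (matA11 a) := by
  refine birEquiv_of_conj (M := !![1, 0, 0; 0, 0, 1; 0, 1, c])
    (N := !![1, 0, 0; 0, -c, 1; 0, 1, 0]) ?_ fun t => ?_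
  · ext i j
    fin_cases i <;> fin_cases j <;> simp [Matrix.mul_apply, Fin.sum_univ_three]
  · ext i j
    fin_cases i <;> fin_cases j <;>
      simp [Matrix.mul_apply, Fin.sum_univ_three, ExpMat.at, matA11, matA12]
    ring

variable (p k) in
/-- The map from the normal forms to the birational classes. -/
noncomputable def classMap [IsAlgClosed k] :
    Unit ⊕ Quotient (glSetoid p k 1) ⊕ Quotient (glSetoid p k 2) → Quotient (birSetoid 3 k) :=
  Sum.elim (fun _ => ⟦ExpMat.id⟧) <| Sum.elim
    (Quotient.lift (fun a => ⟦matA11 (a.1 0)⟧) fun _ _ h => Quotient.sound (matA11_birEquiv h))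
    (Quotient.lift (fun a => ⟦matA12 (a.1 0) (a.1 1)⟧)
      fun _ _ h => Quotient.sound (matA12_birEquiv h))

theorem classMap_injective [IsAlgClosed k] : Function.Injective (classMap p k) := by
  have : Infinite k := IsAlgClosed.instInfinite
  have hspan : ∀ {a₁ a₂ b₁ b₂ : pPoly p k},
      (⟦matA12 a₁ a₂⟧ : Quotient (birSetoid 3 k)) = ⟦matA12 b₁ b₂⟧ →
      Submodule.span k {a₁, a₂} = Submodule.span k {b₁, b₂} := fun h =>
    span_eq_of_birEquiv (Quotient.exact h)
  have h0 : Module.finrank k (Submodule.span k {(0 : pPoly p k), 0}) = 0 := by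
    rw [Set.pair_eq_singleton, Submodule.span_zero_singleton, finrank_bot]
  have hrank : ∀ {V W : Submodule k (pPoly p k)} {m n : ℕ}, V = W → Module.finrank k V = m →
      Module.finrank k W = n → m = n := fun h h1 h2 => by rw [← h1, ← h2, h]
  rintro (⟨⟩ | x | x) (⟨⟩ | y | y) h
  · rfl
  · induction y using Quotient.inductionOn with | h b => ?_
    simp only [classMap, Sum.elim_inl, Sum.elim_inr, Quotient.lift_mk, id_eq_matA12 (p := p),
      matA11_eq_matA12] at h
    exact absurd (hrank ((hspan h).trans (span_zero_pair b)) h0 (finrank_span b)) (by norm_num)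
  · induction y using Quotient.inductionOn with | h b => ?_
    simp only [classMap, Sum.elim_inl, Sum.elim_inr, Quotient.lift_mk, id_eq_matA12 (p := p)] at h
    exact absurd (hrank ((hspan h).trans (span_pair b)) h0 (finrank_span b)) (by norm_num)
  · induction x using Quotient.inductionOn with | h a => ?_
    simp only [classMap, Sum.elim_inl, Sum.elim_inr, Quotient.lift_mk, id_eq_matA12 (p := p),
      matA11_eq_matA12] at h
    exact absurd (hrank ((hspan h).symm.trans (span_zero_pair a)) h0 (finrank_span a))
      (by norm_num)
  · induction x using Quotient.inductionOn with | h a => ?_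
    induction y using Quotient.inductionOn with | h b => ?_
    simp only [classMap, Sum.elim_inl, Sum.elim_inr, Quotient.lift_mk, matA11_eq_matA12] at h
    have := hspan h
    rw [span_zero_pair, span_zero_pair] at this
    rw [Quotient.sound (glEquiv_of_span_eq this)]
  · induction x using Quotient.inductionOn with | h a => ?_
    induction y using Quotient.inductionOn with | h b => ?_
    simp only [classMap, Sum.elim_inr, Sum.elim_inl, Quotient.lift_mk, matA11_eq_matA12] at h
    have := hspan h
    rw [span_zero_pair, span_pair] at this
    exact absurd (hrank this (finrank_span a) (finrank_span b)) (by norm_num)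
  · induction x using Quotient.inductionOn with | h a => ?_
    simp only [classMap, Sum.elim_inl, Sum.elim_inr, Quotient.lift_mk, id_eq_matA12 (p := p)] at h
    exact absurd (hrank ((hspan h).symm.trans (span_pair a)) h0 (finrank_span a)) (by norm_num)
  · induction x using Quotient.inductionOn with | h a => ?_
    induction y using Quotient.inductionOn with | h b => ?_
    simp only [classMap, Sum.elim_inr, Sum.elim_inl, Quotient.lift_mk, matA11_eq_matA12] at h
    have := hspan h
    rw [span_zero_pair, span_pair] at this
    exact absurd (hrank this (finrank_span a) (finrank_span b)) (by norm_num)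
  · induction x using Quotient.inductionOn with | h a => ?_
    induction y using Quotient.inductionOn with | h b => ?_
    simp only [classMap, Sum.elim_inr, Quotient.lift_mk] at h
    have := hspan h
    rw [span_pair, span_pair] at this
    rw [Quotient.sound (glEquiv_of_span_eq this)]

theorem classMap_surjective [IsAlgClosed k] : Function.Surjective (classMap p k) := by
  have : Infinite k := IsAlgClosed.instInfinite
  have h11 : ∀ a : pPoly p k, ∃ x, classMap p k x = ⟦matA11 a⟧ := by
    intro a
    by_cases ha : a = 0
    · exact ⟨Sum.inl (), by rw [ha, matA11_eq_matA12, ← id_eq_matA12]; rfl⟩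
    · exact ⟨Sum.inr (Sum.inl ⟦⟨fun _ => a, LinearIndependent.of_subsingleton 0 ha⟩⟧), rfl⟩
  intro y
  induction y using Quotient.inductionOn with | h A => ?_
  obtain ⟨a₁, a₂, hA⟩ := exists_birEquiv_matA12 (p := p) A
  rw [Quotient.sound hA]
  by_cases h1 : a₁ = 0
  · rw [h1, ← matA11_eq_matA12]
    exact h11 a₂
  by_cases h2 : ∃ c : k, c • a₁ = a₂
  · obtain ⟨c, rfl⟩ := h2
    rw [Quotient.sound (matA12_smul_birEquiv a₁ c)]
    exact h11 a₁
  · push Not at h2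
    exact ⟨Sum.inr (Sum.inr ⟦⟨![a₁, a₂], (LinearIndependent.pair_iff' h1).2 h2⟩⟧), rfl⟩

end Classification

end ExpMatrix

theorem theorem5p11 (p : ℕ) [Fact p.Prime] (k : Type*) [Field k] [IsAlgClosed k] [CharP k p] :
    ∃ Φ : Unit ⊕ Quotient (ExpMatrix.glSetoid p k 1) ⊕ Quotient (ExpMatrix.glSetoid p k 2) ≃
        Quotient (ExpMatrix.birSetoid 3 k),
      Φ (Sum.inl ()) = ⟦ExpMatrix.ExpMat.id⟧ ∧
      (∀ α : ExpMatrix.IndepTuple p k 1,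
        Φ (Sum.inr (Sum.inl ⟦α⟧)) = ⟦ExpMatrix.matA11 (α.1 0)⟧) ∧
      (∀ α : ExpMatrix.IndepTuple p k 2,
        Φ (Sum.inr (Sum.inr ⟦α⟧)) = ⟦ExpMatrix.matA12 (α.1 0) (α.1 1)⟧) :=
  ⟨Equiv.ofBijective (ExpMatrix.classMap p k)
    ⟨ExpMatrix.classMap_injective, ExpMatrix.classMap_surjective⟩,
    rfl, fun _ => rfl, fun _ => rfl⟩
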